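/- **Setting.** Let $A\in\mathbb R^{n\times n}$, $B\in\mathbb R^{n\times l}$ with $(A,B)$ stabilizable, $E\in\mathbb R^{n\times m}$, $z\in\mathbb R^n$; let $Q_1,Q_2,R_2$ be symmetric positive semidefinite, $R_1$ symmetric positive definite, $s\in\mathbb R^n$, $v\in\mathbb R^l$, $c\in\mathbb R$. On a probability space $(\Omega,\mathcal F,\mathbb P)$ let $W(0),W(1),\dots$ be i.i.d. random vectors in $L^2(\Omega;\mathbb R^m)$ with mean $\mu_W$. Put $f(x,u,w)=Ax+Bu+Ew+z$ and, for $X,U$ in $L^2$, $$\ell(X,U)=\mathbb E\big[X^TQ_1X+U^TR_1U+s^TX+v^TU+c\big]+\operatorname{tr}\big(Q_2\operatorname{Cov}(X)+R_2\operatorname{Cov}(U)\big).$$ For $X_0\in L^2$ and a control process $U$, $X_U(\cdot)$ is the solution of $X(k+1)=f(X(k),U(k),W(k))$, $X(0)=X_0$, and $J_N(X_0,U)=\sum_{k=0}^{N-1}\ell(X_U(k),U(k))$. A control process on $\{0,\dots,N-1\}$ is admissible if, for each $k<N$, $U(k)$ is in $L^2$ and $\sigma(X_U(0),\dots,X_U(k))$-measurable,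 and $W(k)$ is independent of $X_U(k)$ and of $U(k)$. $\mathcal K_\infty$ is the class of continuous, strictly increasing, unbounded $\alpha:[0,\infty)\to[0,\infty)$ with $\alpha(0)=0$. A pair of processes $(X^s,U^s)$ is stationary if all $X^s(k)$ have the same law, all $U^s(k)$ have the same law, both laws have finite second moment, $W(k)$ is independent of $X^s(k)$ and of $U^s(k)$, and $X^s(k+1)=f(X^s(k),U^s(k),W(k))$ for all $k$. The problem is strictly dissipative in $L^2$ at $(X^s,U^s)$ with storage function $\lambda$ and comparison function $\alpha\in\mathcal K_\infty$ if $\lambda(k,X)\in\mathbb R$ is bounded from below uniformly in $k\in\mathbb N_0$ and $X\in L^2$, and $$\ell(X,U)-\ell(X^s(k),U^s(k))+\lambda(k,X)-\lambda(k+1,f(X,U,W(k)))\ \ge\ \alpha\big(\mathbb E\|X-X^s(k)\|^2\big)$$ for all $k$ and all $X,U$ in $L^2$ such that $W(k)$ is independent of $X$ and of $U$. **Theorem.** Assume that $(I-A)x^s-Bu^s=E\mu_W+z$ for some $(x^s,u^s)$ and that $(A,Q_1^{1/2})$ is detectable. Then there exist a positive semidefinite solution $P$ of $$P=A^TPA+(Q_1+Q_2)-A^TPB\,[(R_1+R_2)+B^TPB]^{-1}B^TPA,$$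 a symmetric positive definite $S$, $q\in\mathbb R^n$, a pair $(\tilde x,\tilde u)$ with $(I-A)\tilde x-B\tilde u=0$, a function $\alpha\in\mathcal K_\infty$, and a probability measure $\varrho$ on $\mathbb R^n$ with finite second moment, such that, with $K=-[(R_1+R_2)+B^TPB]^{-1}B^TPA$ and $\pi(x)=K(x-\tilde x-x^s)+\tilde u+u^s$, the following holds. The measure $\varrho$ is invariant for $X^+=f(X,\pi(X),W)$, $W\sim W(0)$ independent of $X$; and if $\Omega$ carries a uniformly distributed random variable independent of $(W(k))_k$, then there is a random vector with law $\varrho$ independent of $(W(k))_k$. For every $X^s_\star(0)\sim\varrho$ independent of $(W(k))_k$, the processes $X^s_\star(k+1)=f(X^s_\star(k),U^s_\star(k),W(k))$, $U^s_\star(k)=\pi(X^s_\star(k))$ satisfy: 1. $(X^s_\star,U^s_\star)$ is stationary, and the problem is strictly dissipative in $L^2$ at $(X^s_\star,U^s_\star)$ with comparison function $\alpha$ and storage function $\lambda(k,X)=\mathbb E\big[\|X-(X^s_\star(k)-\tilde x)\|^2_{P+S}-\|X-x^s\|_P^2+q^T(X-(X^s_\star(k)-\tilde x))\big]$, where $\|x\|_M^2=x^TMx$.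 2. For every $X_0\in L^2$ there is $C\in\mathbb R$ such that for all $N\in\mathbb N_0$, all $\delta>0$, all admissible $U$ with $J_N(X_0,U)\le\delta+\sum_{k=0}^{N-1}\ell(X^s_\star(k),U^s_\star(k))$ and all $\varepsilon>0$, the numbers $$\mathcal M^1_\varepsilon=\#\{k<N:\ \|\mathbb E X_U(k)-\mathbb E X^s_\star(k)\|\le\varepsilon\},$$ $$\mathcal M^2_\varepsilon=\#\Big\{k<N:\ \Big|\sqrt{\operatorname{tr}\operatorname{Cov}X_U(k)}-\sqrt{\operatorname{tr}\operatorname{Cov}X^s_\star(k)}\Big|\le\varepsilon\Big\}$$ satisfy $\mathcal M^1_\varepsilon\ge N-(\delta+C)/\alpha(\sqrt{\varepsilon})$ and $\mathcal M^2_\varepsilon\ge N-(\delta+C)/\alpha(\sqrt{2\varepsilon})$. 3. If the problem is strictly dissipative in $L^2$ at $(X^s_\star,U^s_\star)$ with an arbitrary storage function and comparison function $\beta\in\mathcal K_\infty$, then the assertion of item 2 holds (with a constant $C$ that may depend on these) with the bounds $\mathcal M^1_\varepsilon\ge N-(\delta+C)/\beta(\varepsilon^2)$ and $\mathcal M^2_\varepsilon\ge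 N-(\delta+C)/\beta(\varepsilon^2)$. -/

import Mathlib

open MeasureTheory ProbabilityTheory
open scoped Matrix MatrixOrder

namespace StochLQ

/-- `ℝᵈ` with the Euclidean norm. -/
abbrev Vec (d : ℕ) : Type := EuclideanSpace ℝ (Fin d)

/-- The matrix-vector product `M x`. -/
noncomputable def mv {a b : ℕ} (M : Matrix (Fin a) (Fin b) ℝ) (x : Vec b) : Vec a :=
  Matrix.toEuclideanLin M x

/-- The quadratic form `xᵀ M x`, written `‖x‖²_M`. -/
noncomputable def qf {d : ℕ} (M : Matrix (Fin d) (Fin d) ℝ) (x : Vec d) : ℝ :=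
  inner ℝ x (mv M x)

/-- All complex eigenvalues lie in the open unit disc. -/
def IsSchurStable {d : ℕ} (M : Matrix (Fin d) (Fin d) ℝ) : Prop :=
  ∀ μ ∈ spectrum ℂ (M.map (algebraMap ℝ ℂ)), ‖μ‖ < 1

def IsStabilizable {n l : ℕ} (A : Matrix (Fin n) (Fin n) ℝ) (B : Matrix (Fin n) (Fin l) ℝ) :
    Prop :=
  ∃ F : Matrix (Fin l) (Fin n) ℝ, IsSchurStable (A + B * F)

def IsDetectable {n p : ℕ} (A : Matrix (Fin n) (Fin n) ℝ) (C : Matrix (Fin p) (Fin n) ℝ) :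
    Prop :=
  ∃ L : Matrix (Fin n) (Fin p) ℝ, IsSchurStable (A + L * C)

/-- Class `𝒦_∞`; only the values of `α` on `[0, ∞)` matter. -/
structure IsClassKInfty (α : ℝ → ℝ) : Prop where
  continuousOn : ContinuousOn α (Set.Ici 0)
  strictMonoOn : StrictMonoOn α (Set.Ici 0)
  map_zero : α 0 = 0
  unbounded : ∀ b : ℝ, ∃ t : ℝ, 0 ≤ t ∧ b ≤ α t

/-- The coefficients of the dynamics `X⁺ = A X + B U + E W + z` and of the stage cost. -/
structure Data (n l m : ℕ) where
  A : Matrix (Fin n) (Fin n) ℝ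
  B : Matrix (Fin n) (Fin l) ℝ
  E : Matrix (Fin n) (Fin m) ℝ
  z : Vec n
  Q₁ : Matrix (Fin n) (Fin n) ℝ
  Q₂ : Matrix (Fin n) (Fin n) ℝ
  R₁ : Matrix (Fin l) (Fin l) ℝ
  R₂ : Matrix (Fin l) (Fin l) ℝ
  s : Vec n
  v : Vec l
  c : ℝ

variable {n l m : ℕ} {Ω : Type*} [MeasurableSpace Ω]

/-- The dynamics `f(x, u, w) = A x + B u + E w + z`. -/
noncomputable def Data.f (D : Data n l m) (x : Vec n) (u : Vec l) (w : Vec m) : Vec n :=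
  mv D.A x + mv D.B u + mv D.E w + D.z

/-- The covariance matrix of a random vector. -/
noncomputable def covMat {d : ℕ} (Pr : Measure Ω) (X : Ω → Vec d) : Matrix (Fin d) (Fin d) ℝ :=
  Matrix.of fun i j => cov[fun ω => X ω i, fun ω => X ω j; Pr]

/-- The stage cost `ℓ(X, U)`. -/
noncomputable def Data.cost (D : Data n l m) (Pr : Measure Ω) (X : Ω → Vec n) (U : Ω → Vec l) : ℝ :=
  (∫ ω, (qf D.Q₁ (X ω) + qf D.R₁ (U ω) + inner ℝ D.s (X ω) + inner ℝ D.v (U ω) + D.c) ∂Pr)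
    + (D.Q₂ * covMat Pr X).trace + (D.R₂ * covMat Pr U).trace

/-- The solution `X_U(·, X₀)`. -/
noncomputable def Data.traj (D : Data n l m) (W : ℕ → Ω → Vec m) (X₀ : Ω → Vec n)
    (U : ℕ → Ω → Vec l) : ℕ → Ω → Vec n
  | 0 => X₀
  | k + 1 => fun ω => D.f (D.traj W X₀ U k ω) (U k ω) (W k ω)

/-- The total cost `J_N(X₀, U)`. -/
noncomputable def Data.totalCost (D : Data n l m) (Pr : Measure Ω) (W : ℕ → Ω → Vec m)
    (X₀ : Ω → Vec n) (N : ℕ) (U : ℕ → Ω → Vec l) : ℝ :=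
  ∑ k ∈ Finset.range N, D.cost Pr (D.traj W X₀ U k) (U k)

/-- The `σ`-algebra `σ(X(0), …, X(k))`. -/
abbrev history (X : ℕ → Ω → Vec n) (k : ℕ) : MeasurableSpace Ω :=
  ⨆ (j : ℕ) (_ : j ≤ k), MeasurableSpace.comap (X j) inferInstance

/-- Control processes of the problem on `{0, …, N-1}`: square integrable, adapted to the filtration
generated by the state, with `W(k)` independent of `X(k)` and of `U(k)`. -/
structure Data.IsAdmissible (D : Data n l m) (Pr : Measure Ω) (W : ℕ → Ω → Vec m)
    (X₀ : Ω → Vec n) (N : ℕ) (U : ℕ → Ω → Vec l) : Prop where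
  memLp : ∀ k < N, MemLp (U k) 2 Pr
  adapted : ∀ k < N, Measurable[history (D.traj W X₀ U) k] (U k)
  indep_state : ∀ k < N, IndepFun (D.traj W X₀ U k) (W k) Pr
  indep_control : ∀ k < N, IndepFun (U k) (W k) Pr

/-- Stationary pairs of state and control processes. -/
structure Data.IsStationaryPair (D : Data n l m) (Pr : Measure Ω) (W : ℕ → Ω → Vec m)
    (Xs : ℕ → Ω → Vec n) (Us : ℕ → Ω → Vec l) : Prop where
  law_state : ∃ ρ : Measure (Vec n), IsProbabilityMeasure ρ ∧ MemLp id 2 ρ ∧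
    ∀ k, HasLaw (Xs k) ρ Pr
  law_control : ∃ ρ : Measure (Vec l), IsProbabilityMeasure ρ ∧ MemLp id 2 ρ ∧
    ∀ k, HasLaw (Us k) ρ Pr
  dynamics : ∀ k, Xs (k + 1) =ᵐ[Pr] fun ω => D.f (Xs k ω) (Us k ω) (W k ω)
  indep_state : ∀ k, IndepFun (Xs k) (W k) Pr
  indep_control : ∀ k, IndepFun (Us k) (W k) Pr

/-- Strict dissipativity in `L²` at `(Xs, Us)` with storage function `lam` and comparison
function `α`. -/
structure Data.IsStrictlyDissipative (D : Data n l m) (Pr : Measure Ω) (W : ℕ → Ω → Vec m)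
    (Xs : ℕ → Ω → Vec n) (Us : ℕ → Ω → Vec l) (lam : ℕ → (Ω → Vec n) → ℝ) (α : ℝ → ℝ) : Prop where
  bddBelow : ∃ M : ℝ, ∀ k X, MemLp X 2 Pr → M ≤ lam k X
  kInfty : IsClassKInfty α
  ineq : ∀ k X U, MemLp X 2 Pr → MemLp U 2 Pr → IndepFun X (W k) Pr → IndepFun U (W k) Pr →
    α (∫ ω, ‖X ω - Xs k ω‖ ^ 2 ∂Pr) ≤
      D.cost Pr X U - D.cost Pr (Xs k) (Us k)
        + lam k X - lam (k + 1) (fun ω => D.f (X ω) (U ω) (W k ω))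

/-- `P` is a positive semidefinite solution of the algebraic Riccati equation with weights
`Q₁ + Q₂` and `R₁ + R₂`. -/
def Data.IsRiccatiSolution (D : Data n l m) (P : Matrix (Fin n) (Fin n) ℝ) : Prop :=
  P.PosSemidef ∧
    P = D.Aᵀ * P * D.A + (D.Q₁ + D.Q₂)
      - D.Aᵀ * P * D.B * ((D.R₁ + D.R₂) + D.Bᵀ * P * D.B)⁻¹ * D.Bᵀ * P * D.A

/-- The gain `K = -[(R₁ + R₂) + Bᵀ P B]⁻¹ Bᵀ P A`. -/
noncomputable def Data.gain (D : Data n l m) (P : Matrix (Fin n) (Fin n) ℝ) :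
    Matrix (Fin l) (Fin n) ℝ :=
  -(((D.R₁ + D.R₂) + D.Bᵀ * P * D.B)⁻¹ * D.Bᵀ * P * D.A)

/-- The affine feedback `x ↦ K (x - xt - xs) + ut + us`. -/
noncomputable def Data.feedback (D : Data n l m) (P : Matrix (Fin n) (Fin n) ℝ)
    (xs xt : Vec n) (us ut : Vec l) (x : Vec n) : Vec l :=
  mv (D.gain P) (x - xt - xs) + ut + us

/-- The storage function
`λ(k, X) = E[‖X - (Xs(k) - xt)‖²_{P+S} - ‖X - xs‖²_P + qᵀ (X - (Xs(k) - xt))]`. -/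
noncomputable def storage (Pr : Measure Ω) (P S : Matrix (Fin n) (Fin n) ℝ) (q xs xt : Vec n)
    (Xs : ℕ → Ω → Vec n) (k : ℕ) (X : Ω → Vec n) : ℝ :=
  ∫ ω, (qf (P + S) (X ω - (Xs k ω - xt)) - qf P (X ω - xs)
    + inner ℝ q (X ω - (Xs k ω - xt))) ∂Pr

/-- The number of times `k < N` with `‖E X(k) - E Xs(k)‖ ≤ ε`. -/
noncomputable def meanCount (Pr : Measure Ω) (X Xs : ℕ → Ω → Vec n) (N : ℕ) (ε : ℝ) : ℕ :=
  Set.ncard {k : ℕ | k < N ∧ ‖(∫ ω, X k ω ∂Pr) - ∫ ω, Xs k ω ∂Pr‖ ≤ ε}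

/-- The number of times `k < N` with `|√(tr Cov X(k)) - √(tr Cov Xs(k))| ≤ ε`. -/
noncomputable def varCount (Pr : Measure Ω) (X Xs : ℕ → Ω → Vec n) (N : ℕ) (ε : ℝ) : ℕ :=
  Set.ncard {k : ℕ | k < N ∧
    |√((covMat Pr (X k)).trace) - √((covMat Pr (Xs k)).trace)| ≤ ε}

/-- The turnpike property of the first two moments at `(Xs, Us)`, with rates `a₁(ε)` for the
expectation and `a₂(ε)` for the square root of the trace of the covariance. -/
def Data.MomentTurnpike (D : Data n l m) (Pr : Measure Ω) (W : ℕ → Ω → Vec m)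
    (Xs : ℕ → Ω → Vec n) (Us : ℕ → Ω → Vec l) (a₁ a₂ : ℝ → ℝ) : Prop :=
  ∀ X₀ : Ω → Vec n, Measurable X₀ → MemLp X₀ 2 Pr →
    ∃ C : ℝ, ∀ (N : ℕ) (δ : ℝ), 0 < δ → ∀ U : ℕ → Ω → Vec l, D.IsAdmissible Pr W X₀ N U →
      D.totalCost Pr W X₀ N U ≤ δ + ∑ k ∈ Finset.range N, D.cost Pr (Xs k) (Us k) →
      ∀ ε : ℝ, 0 < ε →
        (N : ℝ) - (δ + C) / a₁ ε ≤ meanCount Pr (D.traj W X₀ U) Xs N ε ∧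
        (N : ℝ) - (δ + C) / a₂ ε ≤ varCount Pr (D.traj W X₀ U) Xs N ε

end StochLQ

open StochLQ

/-! Everything rests on one matrix inequality. Detectability supplies a positive definite S with
c‖x‖² ≤ ‖x‖²_{Q₁} + ‖u‖²_{R₁} + ‖x‖²_S − ‖Ax+Bu‖²_S (`exists_storage_matrix`). It makes S + P a
strict Lyapunov function for M = A + BK even when P is singular (`exists_closedLoop_pow_bound`). It
also makes the cost definite along directions with Ax + Bu = x, which yields an optimal steady state
with Lagrange multiplier q (`exists_optimal_steadyState`). P is the limit of value iteration started
at 0, bounded because of stabilizability (`exists_isRiccatiSolution`). Since the powers of M decay,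
the closed loop has the law of an L² series ∑ Mᵏ G(k) as invariant law (`exists_invariant_measure`).

For dissipativity let d = X − Xˢ, v = U − Uˢ, and let z be the deviation of Xˢ from its mean, the
optimal steady state. The excess cost is at least a quadratic part in (d, v), plus a part linear in
(d, v) with coefficients at the steady state, plus cross terms of (d, v) with z
(`integral_le_meanVarianceCost_sub`). The multiplier q balances the linear part. The Riccati
equation rewrites the cross terms as 2⟨d, Pz⟩ − 2⟨d⁺, PMz⟩, which is what the difference ‖·‖²_P
terms of the storage function cancel. The S-terms and the quadratic part leave c‖d‖². What remains
has zero expectation, because the noise is centred and independent and Xˢ is stationary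
(`pointwise_dissipation`, `dissipation_step`).

The turnpike bounds follow by summing: the storage telescopes and is bounded below, so the L²
distance can be large only at boundedly many times, and it dominates the distances of means and of
standard deviations (`IsStrictlyDissipative.momentTurnpike`). -/

namespace StochLQ

/-! ### Matrices acting on Euclidean vectors, and quadratic forms. -/

section MatrixAction

variable {a b d : ℕ}

theorem mv_add (M : Matrix (Fin a) (Fin b) ℝ) (x y : Vec b) : mv M (x + y) = mv M x + mv M y :=
  map_add _ _ _

theorem mv_sub (M : Matrix (Fin a) (Fin b) ℝ) (x y : Vec b) : mv M (x - y) = mv M x - mv M y :=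
  map_sub _ _ _

theorem mv_smul (M : Matrix (Fin a) (Fin b) ℝ) (t : ℝ) (x : Vec b) : mv M (t • x) = t • mv M x :=
  map_smul _ _ _

theorem mv_zero (M : Matrix (Fin a) (Fin b) ℝ) : mv M (0 : Vec b) = 0 :=
  map_zero _

theorem add_mv (M N : Matrix (Fin a) (Fin b) ℝ) (x : Vec b) : mv (M + N) x = mv M x + mv N x := by
  simp [mv]

theorem neg_mv (M : Matrix (Fin a) (Fin b) ℝ) (x : Vec b) : mv (-M) x = -mv M x := by
  simp [mv]

theorem smul_mv (t : ℝ) (M : Matrix (Fin a) (Fin b) ℝ) (x : Vec b) :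
    mv (t • M) x = t • mv M x := by
  simp [mv]

theorem mul_mv (M : Matrix (Fin a) (Fin b) ℝ) (N : Matrix (Fin b) (Fin d) ℝ) (x : Vec d) :
    mv (M * N) x = mv M (mv N x) := by
  simp [mv, Matrix.toLpLin_apply]

theorem one_mv (x : Vec a) : mv (1 : Matrix (Fin a) (Fin a) ℝ) x = x := by
  simp [mv]

theorem zero_mv (x : Vec b) : mv (0 : Matrix (Fin a) (Fin b) ℝ) x = 0 := by
  simp [mv]

theorem mv_apply (M : Matrix (Fin a) (Fin b) ℝ) (x : Vec b) (i : Fin a) :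
    mv M x i = ∑ j, M i j * x j := by
  simp [mv, Matrix.toLpLin_apply, Matrix.mulVec, dotProduct]

theorem inner_eq_sum (x y : Vec a) : inner ℝ x y = ∑ i, x i * y i := by
  simp [PiLp.inner_apply, mul_comm]

theorem inner_mv (M : Matrix (Fin a) (Fin b) ℝ) (x : Vec a) (y : Vec b) :
    inner ℝ x (mv M y) = inner ℝ (mv Mᵀ x) y := by
  simp only [inner_eq_sum, mv_apply, Finset.mul_sum, Finset.sum_mul, Matrix.transpose_apply]
  rw [Finset.sum_comm]
  exact Finset.sum_congr rfl fun i _ => Finset.sum_congr rfl fun j _ => by ring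

/-- Matrix-vector multiplication as a continuous linear map. -/
noncomputable def mvL (M : Matrix (Fin a) (Fin b) ℝ) : Vec b →L[ℝ] Vec a :=
  LinearMap.toContinuousLinearMap (Matrix.toEuclideanLin M)

theorem norm_mv_le (M : Matrix (Fin a) (Fin b) ℝ) (x : Vec b) : ‖mv M x‖ ≤ ‖mvL M‖ * ‖x‖ :=
  (mvL M).le_opNorm x

@[fun_prop]
theorem continuous_mv (M : Matrix (Fin a) (Fin b) ℝ) : Continuous (mv M) :=
  (mvL M).continuous

@[fun_prop]
theorem measurable_mv (M : Matrix (Fin a) (Fin b) ℝ) : Measurable (mv M) :=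
  (continuous_mv M).measurable

@[fun_prop]
theorem continuous_qf (M : Matrix (Fin a) (Fin a) ℝ) : Continuous (qf M) := by
  unfold qf; fun_prop

theorem qf_add_matrix (M N : Matrix (Fin a) (Fin a) ℝ) (x : Vec a) :
    qf (M + N) x = qf M x + qf N x := by
  simp [qf, add_mv, inner_add_right]

theorem qf_smul_matrix (t : ℝ) (M : Matrix (Fin a) (Fin a) ℝ) (x : Vec a) :
    qf (t • M) x = t * qf M x := by
  simp [qf, smul_mv, inner_smul_right]

theorem qf_smul (M : Matrix (Fin a) (Fin a) ℝ) (t : ℝ) (x : Vec a) :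
    qf M (t • x) = t ^ 2 * qf M x := by
  simp only [qf, mv_smul, inner_smul_right, real_inner_smul_left]; ring

theorem qf_conj (N : Matrix (Fin a) (Fin b) ℝ) (M : Matrix (Fin a) (Fin a) ℝ) (x : Vec b) :
    qf (Nᵀ * M * N) x = qf M (mv N x) := by
  simp only [qf, mul_mv]
  rw [inner_mv, Matrix.transpose_transpose]

theorem qf_one (x : Vec a) : qf (1 : Matrix (Fin a) (Fin a) ℝ) x = ‖x‖ ^ 2 := by
  simp [qf, one_mv]

theorem qf_zero_matrix (x : Vec a) : qf (0 : Matrix (Fin a) (Fin a) ℝ) x = 0 := by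
  simp [qf, zero_mv]

theorem qf_zero (M : Matrix (Fin a) (Fin a) ℝ) : qf M (0 : Vec a) = 0 := by
  simp [qf]

theorem inner_mv_of_symm {M : Matrix (Fin a) (Fin a) ℝ} (hM : Mᵀ = M) (x y : Vec a) :
    inner ℝ x (mv M y) = inner ℝ y (mv M x) := by
  rw [inner_mv, hM, real_inner_comm]

theorem qf_add {M : Matrix (Fin a) (Fin a) ℝ} (hM : Mᵀ = M) (x y : Vec a) :
    qf M (x + y) = qf M x + 2 * inner ℝ x (mv M y) + qf M y := by
  simp only [qf, mv_add, inner_add_left, inner_add_right]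
  rw [inner_mv_of_symm hM y x]; ring

theorem qf_sub {M : Matrix (Fin a) (Fin a) ℝ} (hM : Mᵀ = M) (x y : Vec a) :
    qf M (x - y) = qf M x - 2 * inner ℝ x (mv M y) + qf M y := by
  simp only [qf, mv_sub, inner_sub_left, inner_sub_right]
  rw [inner_mv_of_symm hM y x]; ring

theorem qf_eq_dotProduct (M : Matrix (Fin a) (Fin a) ℝ) (x : Vec a) :
    qf M x = x.ofLp ⬝ᵥ (M *ᵥ x.ofLp) := by
  simp only [qf, inner_eq_sum, mv_apply, dotProduct, Matrix.mulVec]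

theorem abs_qf_le (M : Matrix (Fin a) (Fin a) ℝ) (x : Vec a) : |qf M x| ≤ ‖mvL M‖ * ‖x‖ ^ 2 := by
  refine (abs_real_inner_le_norm _ _).trans ?_
  nlinarith [norm_mv_le M x, norm_nonneg x]

theorem PosSemidef.transpose_eq {M : Matrix (Fin a) (Fin a) ℝ} (hM : M.PosSemidef) : Mᵀ = M := by
  simpa [Matrix.IsHermitian, Matrix.conjTranspose_eq_transpose_of_trivial] using hM.isHermitian

theorem PosSemidef.qf_nonneg {M : Matrix (Fin a) (Fin a) ℝ} (hM : M.PosSemidef) (x : Vec a) :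
    0 ≤ qf M x := by
  simpa [qf_eq_dotProduct] using hM.dotProduct_mulVec_nonneg x.ofLp

theorem posSemidef_of_qf {M : Matrix (Fin a) (Fin a) ℝ} (hM : Mᵀ = M) (h : ∀ x, 0 ≤ qf M x) :
    M.PosSemidef := by
  refine Matrix.PosSemidef.of_dotProduct_mulVec_nonneg ?_ fun x => ?_
  · rwa [Matrix.IsHermitian, Matrix.conjTranspose_eq_transpose_of_trivial]
  · simpa [qf_eq_dotProduct] using h (WithLp.toLp 2 x)

theorem posDef_of_qf {M : Matrix (Fin a) (Fin a) ℝ} (hM : Mᵀ = M) (h : ∀ x ≠ 0, 0 < qf M x) :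
    M.PosDef := by
  refine Matrix.PosDef.of_dotProduct_mulVec_pos ?_ fun {x} hx => ?_
  · rwa [Matrix.IsHermitian, Matrix.conjTranspose_eq_transpose_of_trivial]
  · simpa [qf_eq_dotProduct] using h (WithLp.toLp 2 x) (by simpa using hx)

theorem PosDef.qf_pos {M : Matrix (Fin a) (Fin a) ℝ} (hM : M.PosDef) {x : Vec a} (hx : x ≠ 0) :
    0 < qf M x := by
  simpa [qf_eq_dotProduct] using hM.dotProduct_mulVec_pos (x := x.ofLp) (by simpa using hx)

/-- By compactness the form attains a positive minimum on the unit sphere, and homogeneity extends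
the bound. The sphere is empty only when the space is zero. -/
theorem PosDef.exists_le_qf {M : Matrix (Fin a) (Fin a) ℝ} (hM : M.PosDef) :
    ∃ r > 0, ∀ x : Vec a, r * ‖x‖ ^ 2 ≤ qf M x := by
  rcases (Metric.sphere (0 : Vec a) 1).eq_empty_or_nonempty with he | hne
  · refine ⟨1, one_pos, fun x => ?_⟩
    have hx : x = 0 := by
      by_contra hx
      have : (‖x‖⁻¹ • x) ∈ Metric.sphere (0 : Vec a) 1 := by
        simp [norm_smul, norm_ne_zero_iff.mpr hx]
      simp [he] at this
    simp [hx, qf_zero]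
  · obtain ⟨y, hy, hmin⟩ := (isCompact_sphere (0 : Vec a) 1).exists_isMinOn hne
      (continuous_qf M).continuousOn
    have hy0 : y ≠ 0 := by rintro rfl; simp at hy
    refine ⟨qf M y, PosDef.qf_pos hM hy0, fun x => ?_⟩
    by_cases hx : x = 0
    · simp [hx, qf_zero]
    have hx' : ‖x‖ ≠ 0 := norm_ne_zero_iff.mpr hx
    have := hmin (show (‖x‖⁻¹ • x) ∈ Metric.sphere (0 : Vec a) 1 by simp [norm_smul, hx'])
    simp only [Set.mem_ofPred_eq, qf_smul] at this
    calc qf M y * ‖x‖ ^ 2 ≤ (‖x‖⁻¹ ^ 2 * qf M x) * ‖x‖ ^ 2 := by gcongr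
      _ = qf M x := by field_simp

end MatrixAction

/-! ### Quadratic Lyapunov functions of Schur stable matrices. -/

section Lyapunov

variable {d : ℕ}

/-- The complexification of a real vector. -/
noncomputable def complexify (x : Vec d) : EuclideanSpace ℂ (Fin d) :=
  WithLp.toLp 2 fun i => (x i : ℂ)

theorem norm_complexify (x : Vec d) : ‖complexify x‖ = ‖x‖ := by
  simp [complexify, EuclideanSpace.norm_eq]

theorem toEuclideanCLM_complexify (M : Matrix (Fin d) (Fin d) ℝ) (x : Vec d) :
    Matrix.toEuclideanCLM (𝕜 := ℂ) (M.map (algebraMap ℝ ℂ)) (complexify x)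
      = complexify (mv M x) := by
  ext i
  simp [complexify, mv_apply, Matrix.mulVec, dotProduct]

theorem toEuclideanCLM_pow_complexify (M : Matrix (Fin d) (Fin d) ℝ) (k : ℕ) (x : Vec d) :
    (Matrix.toEuclideanCLM (𝕜 := ℂ) (M.map (algebraMap ℝ ℂ)) ^ k) (complexify x)
      = complexify (mv (M ^ k) x) := by
  induction k generalizing x with
  | zero => simp [one_mv]
  | succ k ih =>
    rw [pow_succ, mul_apply_eq_comp, toEuclideanCLM_complexify, ih, pow_succ, mul_mv]

/-- A power of a Schur stable matrix is a contraction. -/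
theorem IsSchurStable.exists_pow_contraction {M : Matrix (Fin d) (Fin d) ℝ}
    (hM : IsSchurStable M) : ∃ k : ℕ, ∀ x : Vec d, ‖mv (M ^ k) x‖ ^ 2 ≤ ‖x‖ ^ 2 / 2 := by
  rcases Nat.eq_zero_or_pos d with rfl | hd
  · exact ⟨0, fun x => by simp [Subsingleton.elim x 0, mv_zero]⟩
  have : NeZero d := ⟨hd.ne'⟩
  have : Nontrivial (EuclideanSpace ℂ (Fin d)) := inferInstance
  set T := Matrix.toEuclideanCLM (𝕜 := ℂ) (M.map (algebraMap ℝ ℂ)) with hT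
  have hspec : spectrum ℂ T = spectrum ℂ (M.map (algebraMap ℝ ℂ)) :=
    AlgEquiv.spectrum_eq (Matrix.toEuclideanCLM (𝕜 := ℂ) (n := Fin d)) _
  -- The spectral radius is attained on the nonempty compact spectrum, so it is below 1; Gelfand's
  -- formula then bounds a high power of `T` by `s ^ k`.
  have hr : spectralRadius ℂ T < ((1 : NNReal) : ENNReal) := by
    refine spectrum.spectralRadius_lt_of_forall_lt_of_nonempty (spectrum.nonempty T) ?_
    intro k hk
    rw [hspec] at hk
    exact_mod_cast hM k hk
  obtain ⟨s, hs1, hs2⟩ := ENNReal.lt_iff_exists_nnreal_btwn.mp hr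
  have hs2' : s < 1 := by exact_mod_cast hs2
  have hev := (spectrum.pow_nnnorm_pow_one_div_tendsto_nhds_spectralRadius T).eventually
    (gt_mem_nhds hs1)
  have hpow : ∀ᶠ k : ℕ in Filter.atTop, s ^ k < 1 / 2 :=
    (tendsto_pow_atTop_nhds_zero_of_lt_one zero_le hs2').eventually
      (gt_mem_nhds (by norm_num))
  obtain ⟨k, ⟨hk1, hk2⟩, hk3⟩ := ((hev.and hpow).and (Filter.eventually_gt_atTop 0)).exists
  refine ⟨k, fun x => ?_⟩
  have hTk : ‖T ^ k‖₊ ≤ s ^ k := by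
    have h1 : ((‖T ^ k‖₊ : ENNReal) ^ (1 / (k : ℝ))) ^ (k : ℝ) ≤ (s : ENNReal) ^ (k : ℝ) :=
      ENNReal.rpow_le_rpow hk1.le (by positivity)
    rw [← ENNReal.rpow_mul, one_div, inv_mul_cancel₀ (by positivity), ENNReal.rpow_one,
      ENNReal.rpow_natCast] at h1
    exact_mod_cast h1
  have hTk' : ‖T ^ k‖ ≤ 1 / 2 := by
    have : (‖T ^ k‖₊ : NNReal) ≤ 1 / 2 := hTk.trans hk2.le
    exact_mod_cast this
  have h2 : ‖mv (M ^ k) x‖ ≤ 1 / 2 * ‖x‖ := by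
    rw [← norm_complexify, ← toEuclideanCLM_pow_complexify, ← norm_complexify x]
    exact (ContinuousLinearMap.le_opNorm _ _).trans (by gcongr)
  nlinarith [norm_nonneg (mv (M ^ k) x), norm_nonneg x]

/-- A Schur stable matrix admits a quadratic Lyapunov function. -/
theorem IsSchurStable.exists_lyapunov {M : Matrix (Fin d) (Fin d) ℝ} (hM : IsSchurStable M) :
    ∃ S : Matrix (Fin d) (Fin d) ℝ, S.PosDef ∧ ∀ x, qf S (mv M x) ≤ qf S x - ‖x‖ ^ 2 := by
  obtain ⟨k, hk⟩ := hM.exists_pow_contraction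
  -- Truncating the usual Lyapunov series at a contracting power suffices: the decrease telescopes
  -- to ‖x‖² − ‖Mᵏx‖² ≥ ‖x‖²/2, and doubling `T` normalizes it.
  set T : Matrix (Fin d) (Fin d) ℝ := ∑ i ∈ Finset.range k, (M ^ i)ᵀ * M ^ i with hT
  have hqf : ∀ x, qf T x = ∑ i ∈ Finset.range k, ‖mv (M ^ i) x‖ ^ 2 := by
    intro x
    have : ∀ j, qf (∑ i ∈ Finset.range j, (M ^ i)ᵀ * M ^ i) x
        = ∑ i ∈ Finset.range j, ‖mv (M ^ i) x‖ ^ 2 := by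
      intro j
      induction j with
      | zero => simp [qf_zero_matrix]
      | succ j ih =>
        rw [Finset.sum_range_succ, Finset.sum_range_succ, qf_add_matrix, ih, ← qf_one, ← qf_conj,
          mul_one]
    exact this k
  have hsym : Tᵀ = T := by
    simp [hT, Matrix.transpose_sum, Matrix.transpose_mul]
  have hdec : ∀ x, qf T (mv M x) ≤ qf T x - ‖x‖ ^ 2 / 2 := by
    intro x
    have h1 : qf T (mv M x) = ∑ i ∈ Finset.range k, ‖mv (M ^ (i + 1)) x‖ ^ 2 := by
      simp only [hqf, pow_succ, mul_mv]
    have h2 := Finset.sum_range_succ' (fun i => ‖mv (M ^ i) x‖ ^ 2) k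
    rw [Finset.sum_range_succ] at h2
    simp only [pow_zero, one_mv] at h2
    rw [h1, hqf]
    linarith [hk x]
  have hTnn : ∀ x, 0 ≤ qf T x := fun x => by
    rw [hqf]; positivity
  refine ⟨(2 : ℝ) • T, posDef_of_qf (by simp [hsym]) fun x hx => ?_, fun x => ?_⟩
  · rw [qf_smul_matrix]
    have := hdec x
    have : 0 < ‖x‖ ^ 2 := by positivity
    linarith [hTnn (mv M x), hdec x]
  · rw [qf_smul_matrix, qf_smul_matrix]
    linarith [hdec x]

end Lyapunov

/-! ### Detectability as dissipativity, and exponential decay from a Lyapunov function. -/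

section Detectability

variable {n l m : ℕ}

theorem norm_sq_mv_sqrt {d : ℕ} {Q : Matrix (Fin d) (Fin d) ℝ} (hQ : Q.PosSemidef) (x : Vec d) :
    ‖mv (CFC.sqrt Q) x‖ ^ 2 = qf Q x := by
  have hs : (CFC.sqrt Q)ᵀ = CFC.sqrt Q :=
    PosSemidef.transpose_eq (Matrix.nonneg_iff_posSemidef.mp (CFC.sqrt_nonneg Q))
  rw [← qf_one, ← qf_conj, mul_one, hs, CFC.sqrt_mul_sqrt_self Q hQ.nonneg]

/-- Detectability yields a quadratic storage function for the deterministic system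
`x⁺ = A x + B u` with supply rate `‖x‖²_Q + ‖u‖²_R`. -/
theorem exists_storage_matrix {A : Matrix (Fin n) (Fin n) ℝ} (B : Matrix (Fin n) (Fin l) ℝ)
    {Q : Matrix (Fin n) (Fin n) ℝ} {R : Matrix (Fin l) (Fin l) ℝ} (hQ : Q.PosSemidef)
    (hR : R.PosDef) (hdet : IsDetectable A (CFC.sqrt Q)) :
    ∃ S : Matrix (Fin n) (Fin n) ℝ, S.PosDef ∧ ∃ r > 0, ∀ x u,
      r * ‖x‖ ^ 2 ≤ qf Q x + qf R u + qf S x - qf S (mv A x + mv B u) := by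
  obtain ⟨L, hL⟩ := hdet
  obtain ⟨S₀, hS₀, hdec⟩ := hL.exists_lyapunov
  obtain ⟨r, hr, hRr⟩ := PosDef.exists_le_qf hR
  set M := A + L * CFC.sqrt Q with hM
  set κ := ‖mvL M‖
  set σ := ‖mvL S₀‖
  set β := ‖mvL B‖
  set τ := ‖mvL L‖
  have hκ : 0 ≤ κ := norm_nonneg _
  have hσ : 0 ≤ σ := norm_nonneg _
  -- First factor: the weight of ‖g‖² after Young's inequality. Second: the bound of ‖g‖² by the
  -- cost. The 1 only ensures positivity.
  set c := (2 * κ ^ 2 * σ ^ 2 + σ) * (2 * β ^ 2 / r + 2 * τ ^ 2) + 1 with hc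
  have hc0 : 0 < c := by positivity
  have key : ∀ x u, qf S₀ (mv A x + mv B u)
      ≤ qf S₀ x - ‖x‖ ^ 2 / 2 + c * (qf Q x + qf R u) := by
    intro x u
    -- Output injection: the successor state is the stable `mv M x` plus an error `g` that the stage
    -- cost controls.
    set g := mv B u - mv L (mv (CFC.sqrt Q) x) with hg
    have hsplit : mv A x + mv B u = mv M x + g := by
      rw [hM, add_mv, mul_mv, hg]; abel
    have hQx : ‖mv (CFC.sqrt Q) x‖ ^ 2 = qf Q x := norm_sq_mv_sqrt hQ x
    have hQ0 := PosSemidef.qf_nonneg hQ x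
    have hR0 := PosSemidef.qf_nonneg hR.posSemidef u
    have hg1 : ‖g‖ ≤ β * ‖u‖ + τ * ‖mv (CFC.sqrt Q) x‖ :=
      (norm_sub_le _ _).trans (add_le_add (norm_mv_le _ _) (norm_mv_le _ _))
    have hu : ‖u‖ ^ 2 ≤ qf R u / r := by
      rw [le_div_iff₀ hr]; linarith [hRr u]
    have hg2 : ‖g‖ ^ 2 ≤ 2 * β ^ 2 * (qf R u / r) + 2 * τ ^ 2 * qf Q x := by
      have h1 : ‖g‖ ^ 2 ≤ (β * ‖u‖ + τ * ‖mv (CFC.sqrt Q) x‖) ^ 2 := by gcongr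
      have h2 : β ^ 2 * ‖u‖ ^ 2 ≤ β ^ 2 * (qf R u / r) := by gcongr
      nlinarith [sq_nonneg (β * ‖u‖ - τ * ‖mv (CFC.sqrt Q) x‖)]
    have hg3 : ‖g‖ ^ 2 ≤ (2 * β ^ 2 / r + 2 * τ ^ 2) * (qf Q x + qf R u) := by
      have e : (2 * β ^ 2 / r + 2 * τ ^ 2) * (qf Q x + qf R u)
        = 2 * β ^ 2 * (qf R u / r) + 2 * τ ^ 2 * qf Q x
          + (2 * β ^ 2 / r * qf Q x + 2 * τ ^ 2 * qf R u) := by ring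
      have : 0 ≤ 2 * β ^ 2 / r * qf Q x + 2 * τ ^ 2 * qf R u := by positivity
      linarith
    have hcross : 2 * inner ℝ (mv M x) (mv S₀ g) ≤ ‖x‖ ^ 2 / 2 + 2 * κ ^ 2 * σ ^ 2 * ‖g‖ ^ 2 := by
      have h1 : inner ℝ (mv M x) (mv S₀ g) ≤ (κ * ‖x‖) * (σ * ‖g‖) :=
        (real_inner_le_norm _ _).trans
          (mul_le_mul (norm_mv_le _ _) (norm_mv_le _ _) (norm_nonneg _) (by positivity))
      nlinarith [sq_nonneg (‖x‖ - 2 * (κ * σ * ‖g‖))]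
    have hgq : qf S₀ g ≤ σ * ‖g‖ ^ 2 := (le_abs_self _).trans (abs_qf_le _ _)
    rw [hsplit, qf_add (PosSemidef.transpose_eq hS₀.posSemidef)]
    have h5 : (2 * κ ^ 2 * σ ^ 2 + σ) * ‖g‖ ^ 2 ≤ c * (qf Q x + qf R u) := by
      have : (2 * κ ^ 2 * σ ^ 2 + σ) * ‖g‖ ^ 2 ≤ (2 * κ ^ 2 * σ ^ 2 + σ) *
        ((2 * β ^ 2 / r + 2 * τ ^ 2) * (qf Q x + qf R u)) := by gcongr
      rw [hc]; nlinarith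
    linarith [hdec x]
  refine ⟨c⁻¹ • S₀, hS₀.smul (inv_pos.mpr hc0), c⁻¹ / 2, by positivity, fun x u => ?_⟩
  rw [qf_smul_matrix, qf_smul_matrix]
  have h := mul_le_mul_of_nonneg_left (key x u) (inv_nonneg.mpr hc0.le)
  have e : c⁻¹ * (qf S₀ x - ‖x‖ ^ 2 / 2 + c * (qf Q x + qf R u))
      = c⁻¹ * qf S₀ x - c⁻¹ / 2 * ‖x‖ ^ 2 + (qf Q x + qf R u) := by
    field_simp
  linarith

/-- A strict quadratic Lyapunov function forces exponential decay of the powers. -/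
theorem exists_pow_bound_of_lyapunov {d : ℕ} {M V : Matrix (Fin d) (Fin d) ℝ} (hV : V.PosDef)
    {c : ℝ} (hc : 0 < c) (h : ∀ x, qf V (mv M x) ≤ qf V x - c * ‖x‖ ^ 2) :
    ∃ C r : ℝ, 0 ≤ C ∧ 0 ≤ r ∧ r < 1 ∧ ∀ k x, ‖mv (M ^ k) x‖ ≤ C * r ^ k * ‖x‖ := by
  obtain ⟨s, hs, hVs⟩ := PosDef.exists_le_qf hV
  -- Adding `c` forces `c ≤ κ`, so that the decay factor `1 - c / κ` is nonnegative.
  set κ := ‖mvL V‖ + c with hκ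
  have hκc : c ≤ κ := le_add_of_nonneg_left (norm_nonneg _)
  have hκ0 : 0 < κ := hc.trans_le hκc
  have hVκ : ∀ x, qf V x ≤ κ * ‖x‖ ^ 2 := fun x => by
    have := (le_abs_self _).trans (abs_qf_le V x)
    rw [hκ]; nlinarith [sq_nonneg ‖x‖]
  set t := 1 - c / κ with ht
  have ht0 : 0 ≤ t := by
    rw [ht, sub_nonneg, div_le_one hκ0]; exact hκc
  have ht1 : t < 1 := by
    rw [ht]; linarith [div_pos hc hκ0]
  have hstep : ∀ x, qf V (mv M x) ≤ t * qf V x := fun x => by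
    have h1 : c / κ * qf V x ≤ c * ‖x‖ ^ 2 := by
      rw [div_mul_eq_mul_div, div_le_iff₀ hκ0]; nlinarith [hVκ x]
    have := h x
    rw [ht]; linarith
  have hpow : ∀ k x, qf V (mv (M ^ k) x) ≤ t ^ k * qf V x := by
    intro k
    induction k with
    | zero => intro x; simp [one_mv]
    | succ k ih =>
      intro x
      rw [pow_succ' M, mul_mv]
      calc _ ≤ t * qf V (mv (M ^ k) x) := hstep _
        _ ≤ t * (t ^ k * qf V x) := by gcongr; exact ih x
        _ = _ := by ring
  refine ⟨√(κ / s), √t, by positivity, by positivity, ?_, fun k x => ?_⟩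
  · rw [Real.sqrt_lt' one_pos]; simpa using ht1
  · refine abs_le_of_sq_le_sq' ?_ (by positivity) |>.2
    have h1 : s * ‖mv (M ^ k) x‖ ^ 2 ≤ t ^ k * (κ * ‖x‖ ^ 2) :=
      (hVs _).trans ((hpow k x).trans (by gcongr; exact hVκ x))
    have e : (√(κ / s) * √t ^ k * ‖x‖) ^ 2 = t ^ k * (κ * ‖x‖ ^ 2) / s := by
      rw [mul_pow, mul_pow, Real.sq_sqrt (by positivity), ← pow_mul, mul_comm k, pow_mul,
        Real.sq_sqrt ht0]
      ring
    rw [e, le_div_iff₀ hs]; linarith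

end Detectability

/-! ### The Riccati equation by value iteration, and closed-loop stability. -/

section Riccati

variable {n l m : ℕ} (D : Data n l m)

/-- The right-hand side of the Riccati equation. -/
noncomputable def Data.ric (P : Matrix (Fin n) (Fin n) ℝ) : Matrix (Fin n) (Fin n) ℝ :=
  D.Aᵀ * P * D.A + (D.Q₁ + D.Q₂)
    - D.Aᵀ * P * D.B * ((D.R₁ + D.R₂) + D.Bᵀ * P * D.B)⁻¹ * D.Bᵀ * P * D.A

variable {D}

theorem posDef_inputWeight (hR₁ : D.R₁.PosDef) (hR₂ : D.R₂.PosSemidef)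
    {P : Matrix (Fin n) (Fin n) ℝ} (hP : P.PosSemidef) :
    ((D.R₁ + D.R₂) + D.Bᵀ * P * D.B).PosDef := by
  refine (hR₁.add_posSemidef hR₂).add_posSemidef ?_
  simpa [Matrix.conjTranspose_eq_transpose_of_trivial] using hP.conjTranspose_mul_mul_same D.B

theorem inputWeight_mul_gain (hR₁ : D.R₁.PosDef) (hR₂ : D.R₂.PosSemidef)
    {P : Matrix (Fin n) (Fin n) ℝ} (hP : P.PosSemidef) :
    ((D.R₁ + D.R₂) + D.Bᵀ * P * D.B) * D.gain P = -(D.Bᵀ * P * D.A) := by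
  have hu := (posDef_inputWeight hR₁ hR₂ hP).isUnit
  rw [Matrix.isUnit_iff_isUnit_det] at hu
  rw [Data.gain, Matrix.mul_neg]
  simp only [Matrix.mul_assoc] at hu ⊢
  rw [Matrix.mul_nonsing_inv_cancel_left _ _ hu]

theorem ric_eq_gain (P : Matrix (Fin n) (Fin n) ℝ) :
    D.ric P = D.Aᵀ * P * D.A + (D.Q₁ + D.Q₂) + D.Aᵀ * P * D.B * D.gain P := by
  simp only [Data.ric, Data.gain, Matrix.mul_neg, Matrix.mul_assoc, sub_eq_add_neg]

/-- Completion of the square in u. It shows that `D.ric P` is the Bellman operator, with minimizer u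
= Kx; the next two lemmas are its equality and inequality halves. -/
theorem qf_ric_add (hR₁ : D.R₁.PosDef) (hR₂ : D.R₂.PosSemidef)
    {P : Matrix (Fin n) (Fin n) ℝ} (hP : P.PosSemidef) (x : Vec n) (u : Vec l) :
    qf (D.Q₁ + D.Q₂) x + qf (D.R₁ + D.R₂) u + qf P (mv D.A x + mv D.B u)
      = qf (D.ric P) x
        + qf ((D.R₁ + D.R₂) + D.Bᵀ * P * D.B) (u - mv (D.gain P) x) := by
  have hG := posDef_inputWeight hR₁ hR₂ hP
  have hGt := PosSemidef.transpose_eq hG.posSemidef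
  have hPt := PosSemidef.transpose_eq hP
  have hGK : ∀ y, mv ((D.R₁ + D.R₂) + D.Bᵀ * P * D.B) (mv (D.gain P) y)
      = -mv D.Bᵀ (mv P (mv D.A y)) := fun y => by
    rw [← mul_mv, inputWeight_mul_gain hR₁ hR₂ hP, neg_mv, mul_mv, mul_mv]
  have hcross : inner ℝ (mv D.A x) (mv P (mv D.B u)) = inner ℝ u (mv D.Bᵀ (mv P (mv D.A x))) := by
    rw [inner_mv_of_symm hPt, inner_mv D.Bᵀ, Matrix.transpose_transpose]
  have hric : qf (D.ric P) x = qf P (mv D.A x) + qf (D.Q₁ + D.Q₂) x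
      + inner ℝ (mv (D.gain P) x) (mv D.Bᵀ (mv P (mv D.A x))) := by
    rw [ric_eq_gain, qf_add_matrix, qf_add_matrix, qf_conj]
    congr 1
    simp only [qf, mul_mv]
    rw [inner_mv, Matrix.transpose_transpose, inner_mv_of_symm hPt, inner_mv D.Bᵀ,
      Matrix.transpose_transpose]
  have hGKK : qf ((D.R₁ + D.R₂) + D.Bᵀ * P * D.B) (mv (D.gain P) x)
      = -inner ℝ (mv (D.gain P) x) (mv D.Bᵀ (mv P (mv D.A x))) := by
    rw [qf, hGK, inner_neg_right]
  rw [qf_sub hGt, hGK, hGKK, hric, qf_add hPt, hcross, qf_add_matrix (D.R₁ + D.R₂), qf_conj,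
    inner_neg_right]
  ring

theorem qf_ric_eq (hR₁ : D.R₁.PosDef) (hR₂ : D.R₂.PosSemidef)
    {P : Matrix (Fin n) (Fin n) ℝ} (hP : P.PosSemidef) (x : Vec n) :
    qf (D.ric P) x = qf (D.Q₁ + D.Q₂) x + qf (D.R₁ + D.R₂) (mv (D.gain P) x)
      + qf P (mv D.A x + mv D.B (mv (D.gain P) x)) := by
  rw [qf_ric_add hR₁ hR₂ hP, sub_self, qf_zero, add_zero]

theorem qf_ric_le (hR₁ : D.R₁.PosDef) (hR₂ : D.R₂.PosSemidef)
    {P : Matrix (Fin n) (Fin n) ℝ} (hP : P.PosSemidef) (x : Vec n) (u : Vec l) :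
    qf (D.ric P) x
      ≤ qf (D.Q₁ + D.Q₂) x + qf (D.R₁ + D.R₂) u + qf P (mv D.A x + mv D.B u) := by
  rw [qf_ric_add hR₁ hR₂ hP]
  linarith [PosSemidef.qf_nonneg (posDef_inputWeight hR₁ hR₂ hP).posSemidef
    (u - mv (D.gain P) x)]

theorem posSemidef_ric (hQ₁ : D.Q₁.PosSemidef) (hQ₂ : D.Q₂.PosSemidef) (hR₁ : D.R₁.PosDef)
    (hR₂ : D.R₂.PosSemidef) {P : Matrix (Fin n) (Fin n) ℝ} (hP : P.PosSemidef) :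
    (D.ric P).PosSemidef := by
  have hPt := PosSemidef.transpose_eq hP
  have hG := PosSemidef.transpose_eq (posDef_inputWeight hR₁ hR₂ hP).posSemidef
  simp only [Matrix.mul_assoc] at hG
  refine posSemidef_of_qf ?_ fun x => ?_
  · rw [Data.ric, Matrix.transpose_sub, Matrix.transpose_add,
      PosSemidef.transpose_eq (hQ₁.add hQ₂)]
    simp only [Matrix.transpose_mul, Matrix.transpose_transpose, Matrix.transpose_nonsing_inv, hG,
      hPt, Matrix.mul_assoc]
  · rw [qf_ric_eq hR₁ hR₂ hP]
    have h1 := PosSemidef.qf_nonneg (hQ₁.add hQ₂) x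
    have h2 := PosSemidef.qf_nonneg (hR₁.posSemidef.add hR₂) (mv (D.gain P) x)
    have h3 := PosSemidef.qf_nonneg hP (mv D.A x + mv D.B (mv (D.gain P) x))
    linarith

theorem continuous_qf_matrix {d : ℕ} (x : Vec d) :
    Continuous fun M : Matrix (Fin d) (Fin d) ℝ => qf M x := by
  simp only [qf_eq_dotProduct]
  fun_prop

/-- A monotone sequence of symmetric matrices that is bounded above converges. -/
theorem exists_tendsto_of_monotone_qf {d : ℕ} {M : ℕ → Matrix (Fin d) (Fin d) ℝ}
    (hsymm : ∀ k, (M k)ᵀ = M k) (hmono : ∀ k x, qf (M k) x ≤ qf (M (k + 1)) x)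
    (hbdd : ∀ x, ∃ b, ∀ k, qf (M k) x ≤ b) :
    ∃ P, Filter.Tendsto M Filter.atTop (nhds P) := by
  have hlim : ∀ x, ∃ t, Filter.Tendsto (fun k => qf (M k) x) Filter.atTop (nhds t) := fun x => by
    obtain ⟨b, hb⟩ := hbdd x
    exact ⟨_, tendsto_atTop_ciSup (monotone_nat_of_le_succ fun k => hmono k x)
      ⟨b, by rintro _ ⟨k, rfl⟩; exact hb k⟩⟩
  choose t ht using hlim
  -- Polarization expresses each entry through three values of the quadratic form, which converge by
  -- monotonicity.
  have hpol : ∀ k i j, M k i j = (qf (M k) (EuclideanSpace.single i 1 + EuclideanSpace.single j 1)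
      - qf (M k) (EuclideanSpace.single i 1) - qf (M k) (EuclideanSpace.single j 1)) / 2 := by
    intro k i j
    have : inner ℝ (EuclideanSpace.single i (1 : ℝ)) (mv (M k) (EuclideanSpace.single j 1))
        = M k i j := by
      rw [EuclideanSpace.inner_single_left, mv_apply]
      simp
    rw [qf_add (hsymm k), this]; ring
  refine ⟨Matrix.of fun i j => (t (EuclideanSpace.single i 1 + EuclideanSpace.single j 1)
      - t (EuclideanSpace.single i 1) - t (EuclideanSpace.single j 1)) / 2, ?_⟩
  refine tendsto_pi_nhds.mpr fun i => tendsto_pi_nhds.mpr fun j => ?_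
  simp only [hpol, Matrix.of_apply]
  exact (((ht _).sub (ht _)).sub (ht _)).div_const 2

/-- Stabilizability implies solvability of the Riccati equation. -/
theorem exists_isRiccatiSolution (hAB : IsStabilizable D.A D.B) (hQ₁ : D.Q₁.PosSemidef)
    (hQ₂ : D.Q₂.PosSemidef) (hR₁ : D.R₁.PosDef) (hR₂ : D.R₂.PosSemidef) :
    ∃ P, D.IsRiccatiSolution P := by
  obtain ⟨F, hF⟩ := hAB
  obtain ⟨T, hT, hdec⟩ := hF.exists_lyapunov
  set κ := ‖mvL (D.Q₁ + D.Q₂)‖ + ‖mvL (D.R₁ + D.R₂)‖ * ‖mvL F‖ ^ 2 with hκ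
  have hcost : ∀ x, qf (D.Q₁ + D.Q₂) x + qf (D.R₁ + D.R₂) (mv F x) ≤ κ * ‖x‖ ^ 2 := fun x => by
    have h1 := (le_abs_self _).trans (abs_qf_le (D.Q₁ + D.Q₂) x)
    have h2 := (le_abs_self _).trans (abs_qf_le (D.R₁ + D.R₂) (mv F x))
    have h3 : ‖mvL (D.R₁ + D.R₂)‖ * ‖mv F x‖ ^ 2
        ≤ ‖mvL (D.R₁ + D.R₂)‖ * (‖mvL F‖ * ‖x‖) ^ 2 := by
      gcongr; exact norm_mv_le F x
    rw [hκ]; linarith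
  have hκ0 : 0 ≤ κ := by positivity
  set p : ℕ → Matrix (Fin n) (Fin n) ℝ := fun k => D.ric^[k] 0 with hp
  have hsucc : ∀ k, p (k + 1) = D.ric (p k) := fun k => Function.iterate_succ_apply' _ _ _
  have hpsd : ∀ k, (p k).PosSemidef := by
    intro k
    induction k with
    | zero => exact Matrix.PosSemidef.zero
    | succ k ih => rw [hsucc]; exact posSemidef_ric hQ₁ hQ₂ hR₁ hR₂ ih
  have hmono : ∀ k x, qf (p k) x ≤ qf (p (k + 1)) x := by
    intro k
    induction k with
    | zero => intro x; simpa [hp, qf_zero_matrix] using PosSemidef.qf_nonneg (hpsd 1) x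
    | succ k ih =>
      intro x
      rw [hsucc (k + 1), qf_ric_eq hR₁ hR₂ (hpsd (k + 1))]
      nth_rewrite 1 [hsucc k]
      -- The gain optimal for `p (k + 1)` serves as a competitor in the step with terminal weight `p
      -- k`.
      exact (qf_ric_le hR₁ hR₂ (hpsd k) x _).trans (add_le_add_right (ih _) _)
  -- The stabilizing feedback `F` is a competitor at every step, and `κ * qf T` decreases along it
  -- by at least the running cost.
  have hbdd : ∀ k x, qf (p k) x ≤ κ * qf T x := by
    intro k
    induction k with
    | zero =>
      intro x
      simpa [hp, qf_zero_matrix] using mul_nonneg hκ0 (PosSemidef.qf_nonneg hT.posSemidef x)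
    | succ k ih =>
      intro x
      have h1 := qf_ric_le hR₁ hR₂ (hpsd k) x (mv F x)
      have h2 := ih (mv D.A x + mv D.B (mv F x))
      have h3 := hdec x
      rw [add_mv, mul_mv] at h3
      rw [hsucc]
      nlinarith [hcost x, mul_le_mul_of_nonneg_left h3 hκ0]
  obtain ⟨P, hP⟩ := exists_tendsto_of_monotone_qf
    (fun k => PosSemidef.transpose_eq (hpsd k)) hmono fun x => ⟨_, fun k => hbdd k x⟩
  have hPsd : P.PosSemidef := by
    refine posSemidef_of_qf ?_ fun x => ?_
    · refine tendsto_nhds_unique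
        (((Continuous.matrix_transpose continuous_id).tendsto P).comp hP) ?_
      simpa only [Function.comp_def, id, PosSemidef.transpose_eq (hpsd _)] using hP
    · exact ge_of_tendsto' (((continuous_qf_matrix x).tendsto P).comp hP)
        fun k => PosSemidef.qf_nonneg (hpsd k) x
  refine ⟨P, hPsd, ?_⟩
  -- The input weight stays positive definite at the limit, so inversion is continuous there and the
  -- fixed-point equation passes to the limit.
  have hinv : Filter.Tendsto (fun k => ((D.R₁ + D.R₂) + D.Bᵀ * p k * D.B)⁻¹) Filter.atTop
      (nhds ((D.R₁ + D.R₂) + D.Bᵀ * P * D.B)⁻¹) := by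
    have hdet : ((D.R₁ + D.R₂) + D.Bᵀ * P * D.B).det ≠ 0 :=
      (posDef_inputWeight hR₁ hR₂ hPsd).det_pos.ne'
    have h1 : ContinuousAt Inv.inv ((D.R₁ + D.R₂) + D.Bᵀ * P * D.B) := by
      refine continuousAt_matrix_inv _ ?_
      rw [Ring.inverse_eq_inv']
      exact continuousAt_inv₀ hdet
    have h2 : Continuous fun X : Matrix (Fin n) (Fin n) ℝ => (D.R₁ + D.R₂) + D.Bᵀ * X * D.B := by
      fun_prop
    exact h1.tendsto.comp ((h2.tendsto P).comp hP)
  have hjoint : Continuous fun X : Matrix (Fin n) (Fin n) ℝ × Matrix (Fin l) (Fin l) ℝ =>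
      D.Aᵀ * X.1 * D.A + (D.Q₁ + D.Q₂) - D.Aᵀ * X.1 * D.B * X.2 * D.Bᵀ * X.1 * D.A := by
    fun_prop
  have hlim := (hjoint.tendsto (P, ((D.R₁ + D.R₂) + D.Bᵀ * P * D.B)⁻¹)).comp
    (hP.prodMk_nhds hinv)
  refine tendsto_nhds_unique (hP.comp (Filter.tendsto_add_atTop_nat 1)) ?_
  simpa only [Function.comp_def, hsucc, Data.ric] using hlim

theorem IsRiccatiSolution.ric_eq {P : Matrix (Fin n) (Fin n) ℝ} (hP : D.IsRiccatiSolution P) :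
    D.ric P = P := hP.2.symm

/-- The closed-loop matrix `A + B K`. -/
noncomputable def Data.closedLoop (D : Data n l m) (P : Matrix (Fin n) (Fin n) ℝ) :
    Matrix (Fin n) (Fin n) ℝ :=
  D.A + D.B * D.gain P

theorem closedLoop_mv (P : Matrix (Fin n) (Fin n) ℝ) (x : Vec n) :
    mv (D.closedLoop P) x = mv D.A x + mv D.B (mv (D.gain P) x) := by
  rw [Data.closedLoop, add_mv, mul_mv]

/-- Along u = Kx the form of P drops by the full running cost, while that of S grows by at most the
Q₁, R₁ part of it minus c‖x‖². Hence S + P decreases strictly. -/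
theorem exists_closedLoop_pow_bound (hQ₂ : D.Q₂.PosSemidef) (hR₁ : D.R₁.PosDef)
    (hR₂ : D.R₂.PosSemidef) {P S : Matrix (Fin n) (Fin n) ℝ} (hP : D.IsRiccatiSolution P)
    (hS : S.PosDef) {c : ℝ} (hc : 0 < c) (h : ∀ x u, c * ‖x‖ ^ 2 ≤
      qf D.Q₁ x + qf D.R₁ u + qf S x - qf S (mv D.A x + mv D.B u)) :
    ∃ C r : ℝ, 0 ≤ C ∧ 0 ≤ r ∧ r < 1 ∧
      ∀ k x, ‖mv (D.closedLoop P ^ k) x‖ ≤ C * r ^ k * ‖x‖ := by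
  refine exists_pow_bound_of_lyapunov (V := S + P) (hS.add_posSemidef hP.1) hc fun x => ?_
  have h1 := h x (mv (D.gain P) x)
  have h2 := qf_ric_eq hR₁ hR₂ hP.1 x
  rw [IsRiccatiSolution.ric_eq hP, ← closedLoop_mv, qf_add_matrix, qf_add_matrix] at h2
  rw [← closedLoop_mv] at h1
  rw [qf_add_matrix, qf_add_matrix]
  have h3 := PosSemidef.qf_nonneg hQ₂ x
  have h4 := PosSemidef.qf_nonneg hR₂ (mv (D.gain P) x)
  linarith

/-- The two stationarity relations of the Riccati gain. -/
theorem riccati_state_relation {P : Matrix (Fin n) (Fin n) ℝ} (hP : D.IsRiccatiSolution P)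
    (y : Vec n) :
    mv P y = mv (D.Q₁ + D.Q₂) y + mv D.Aᵀ (mv P (mv (D.closedLoop P) y)) := by
  conv_lhs => rw [← IsRiccatiSolution.ric_eq hP, ric_eq_gain]
  simp only [add_mv, mul_mv, closedLoop_mv, mv_add]
  abel

theorem riccati_input_relation (hR₁ : D.R₁.PosDef) (hR₂ : D.R₂.PosSemidef)
    {P : Matrix (Fin n) (Fin n) ℝ} (hP : P.PosSemidef) (y : Vec n) :
    mv (D.R₁ + D.R₂) (mv (D.gain P) y) + mv D.Bᵀ (mv P (mv (D.closedLoop P) y)) = 0 := by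
  have h := congrArg (fun M => mv M y) (inputWeight_mul_gain hR₁ hR₂ hP)
  simp only [mul_mv, add_mv, neg_mv] at h
  simp only [closedLoop_mv, mv_add, add_mv]
  rw [← add_eq_zero_iff_eq_neg] at h
  rw [← h]; abel

end Riccati

/-! ### The optimal steady state and its Lagrange multiplier. -/

section OptimalSteadyState

variable {n l m : ℕ} {D : Data n l m}

/-- Optimality conditions of the steady state problem: existence of an optimal steady state
`(xs + xt, us + ut)` together with a Lagrange multiplier `q`. -/
theorem exists_optimal_steadyState (hQ₁ : D.Q₁.PosSemidef) (hR₁ : D.R₁.PosDef)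
    {S : Matrix (Fin n) (Fin n) ℝ} {c : ℝ} (hc : 0 < c) (h : ∀ x u, c * ‖x‖ ^ 2 ≤
      qf D.Q₁ x + qf D.R₁ u + qf S x - qf S (mv D.A x + mv D.B u)) (xs : Vec n) (us : Vec l) :
    ∃ (xt : Vec n) (ut : Vec l) (q : Vec n), xt - mv D.A xt - mv D.B ut = 0 ∧
      ∀ x u, 2 * inner ℝ x (mv D.Q₁ (xs + xt)) + inner ℝ D.s x
        + (2 * inner ℝ u (mv D.R₁ (us + ut)) + inner ℝ D.v u)
        + inner ℝ q (x - mv D.A x - mv D.B u) = 0 := by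
  let T : (Vec n × Vec l) →ₗ[ℝ] Vec n :=
    { toFun := fun p => p.1 - mv D.A p.1 - mv D.B p.2
      map_add' := fun p p' => by simp only [Prod.fst_add, Prod.snd_add, mv_add]; abel
      map_smul' := fun t p => by
        simp only [Prod.smul_fst, Prod.smul_snd, mv_smul, smul_sub, RingHom.id_apply] }
  let a : (Vec n × Vec l) →ₗ[ℝ] (Vec n × Vec l) →ₗ[ℝ] ℝ :=
    LinearMap.mk₂ ℝ (fun p p' => inner ℝ p'.1 (mv D.Q₁ p.1) + inner ℝ p'.2 (mv D.R₁ p.2))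
      (fun _ _ _ => by simp only [Prod.fst_add, Prod.snd_add, mv_add, inner_add_right]; ring)
      (fun _ _ _ => by
        simp only [Prod.smul_fst, Prod.smul_snd, mv_smul, inner_smul_right, smul_eq_mul]; ring)
      (fun _ _ _ => by simp only [Prod.fst_add, Prod.snd_add, inner_add_left]; ring)
      (fun _ _ _ => by
        simp only [Prod.smul_fst, Prod.smul_snd, real_inner_smul_left, smul_eq_mul]; ring)
  let b : (Vec n × Vec l) →ₗ[ℝ] ℝ :=
    { toFun := fun p => inner ℝ D.s p.1 + inner ℝ D.v p.2
      map_add' := fun p p' => by simp only [Prod.fst_add, Prod.snd_add, inner_add_right]; ring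
      map_smul' := fun t p => by
        simp only [Prod.smul_fst, Prod.smul_snd, inner_smul_right, RingHom.id_apply, smul_eq_mul]
        ring }
  let N := LinearMap.ker T
  let φ : N →ₗ[ℝ] Module.Dual ℝ N := (a.domRestrict₁₂ N N)
  have hφ : ∀ p p' : N, φ p p' = a p p' := fun _ _ => rfl
  -- On ker T the state is a fixed point, so the S-terms cancel and vanishing cost forces x = 0,
  -- then u = 0. In finite dimension the critical-point equation on ker T is therefore solvable.
  have hinj : Function.Injective φ := by
    rw [← LinearMap.ker_eq_bot, LinearMap.ker_eq_bot']
    intro p hp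
    have h0 : a p p = 0 := by rw [← hφ, hp]; rfl
    have hpT : (p : Vec n × Vec l).1 - mv D.A (p : Vec n × Vec l).1
        - mv D.B (p : Vec n × Vec l).2 = 0 := p.2
    obtain ⟨⟨x, u⟩, hp⟩ := p
    have h0' : qf D.Q₁ x + qf D.R₁ u = 0 := h0
    have hxu : mv D.A x + mv D.B u = x := by
      rw [sub_sub, sub_eq_zero] at hpT; exact hpT.symm
    have h1 := h x u
    rw [hxu] at h1
    have hx : x = 0 := by
      by_contra hx
      have : 0 < ‖x‖ ^ 2 := by positivity
      nlinarith
    have hu : u = 0 := by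
      by_contra hu
      have := PosDef.qf_pos hR₁ hu
      linarith [PosSemidef.qf_nonneg hQ₁ x]
    subst hx hu
    rfl
  have hsurj : Function.Surjective φ :=
    (LinearMap.injective_iff_surjective_of_finrank_eq_finrank
      Subspace.dual_finrank_eq.symm).mp hinj
  obtain ⟨p, hp⟩ := hsurj ((-(a (xs, us) + (1 / 2 : ℝ) • b)).domRestrict N)
  -- The negative gradient at the critical point vanishes on ker T, hence factors through T; the
  -- Riesz vector of the factor is the multiplier.
  let g : Module.Dual ℝ (Vec n × Vec l) := -((2 : ℝ) • a ((xs, us) + p) + b)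
  have hg : g ∈ LinearMap.range T.dualMap := by
    rw [LinearMap.range_dualMap_eq_dualAnnihilator_ker, Submodule.mem_dualAnnihilator]
    intro w hw
    have h1 : a p w = -(a (xs, us) w + (1 / 2) * b w) := LinearMap.congr_fun hp ⟨w, hw⟩
    change -(2 * a ((xs, us) + p) w + b w) = 0
    rw [map_add, LinearMap.add_apply, h1]; ring
  obtain ⟨ψ, hψ⟩ := hg
  refine ⟨(p : Vec n × Vec l).1, (p : Vec n × Vec l).2,
    (InnerProductSpace.toDual ℝ (Vec n)).symm (LinearMap.toContinuousLinearMap ψ), p.2,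
    fun x u => ?_⟩
  rw [InnerProductSpace.toDual_symm_apply]
  have h1 : ψ (T (x, u)) = -(2 * a ((xs, us) + p) (x, u) + b (x, u)) :=
    LinearMap.congr_fun hψ (x, u)
  have h2 : ψ (x - mv D.A x - mv D.B u) = -(2 * (inner ℝ x (mv D.Q₁ (xs + (p : Vec n × Vec l).1))
    + inner ℝ u (mv D.R₁ (us + (p : Vec n × Vec l).2))) + (inner ℝ D.s x + inner ℝ D.v u)) := h1
  rw [LinearMap.coe_toContinuousLinearMap', h2]; ring

end OptimalSteadyState

/-! ### Independence and laws along a noise-driven recursion. -/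

section Independence

variable {Ω : Type*} [MeasurableSpace Ω] {Pr : Measure Ω}

/-- The noise at time `k` is independent of the whole future noise. -/
theorem indepFun_tail {𝓦 : Type*} [MeasurableSpace 𝓦] {W : ℕ → Ω → 𝓦}
    (hWm : ∀ k, Measurable (W k)) (hW : iIndepFun W Pr) (k : ℕ) :
    IndepFun (W k) (fun ω j => W (k + 1 + j) ω) Pr := by
  have h := indep_iSup_of_disjoint (fun i => (hWm i).comap_le) hW
    (S := {k}) (T := Set.Ioi k) (by simp)
  have h1 : MeasurableSpace.comap (W k) inferInstance
      ≤ ⨆ i ∈ ({k} : Set ℕ), MeasurableSpace.comap (W i) inferInstance :=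
    le_iSup₂_of_le k rfl le_rfl
  have h2 : MeasurableSpace.comap (fun ω j => W (k + 1 + j) ω) MeasurableSpace.pi
      ≤ ⨆ i ∈ Set.Ioi k, MeasurableSpace.comap (W i) inferInstance := by
    rw [← measurable_iff_comap_le]
    refine @measurable_pi_lambda _ _ _ (_) _ _ fun j => ?_
    rw [measurable_iff_comap_le]
    exact le_iSup₂_of_le (k + 1 + j) (by simp only [Set.mem_Ioi]; omega) le_rfl
  exact indep_of_indep_of_le_left (indep_of_indep_of_le_right h h2) h1

variable [IsProbabilityMeasure Pr]

/-- The joint law of the three variables is a triple product, which may be reassociated. This moves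
the current noise from the future to the past. -/
theorem indepFun_prodMk_of_indepFun {𝓧 𝓨 𝓩 : Type*} [MeasurableSpace 𝓧] [MeasurableSpace 𝓨]
    [MeasurableSpace 𝓩] {X : Ω → 𝓧} {Y : Ω → 𝓨} {Z : Ω → 𝓩} (hX : Measurable X)
    (hY : Measurable Y) (hZ : Measurable Z) (h₁ : IndepFun X (fun ω => (Y ω, Z ω)) Pr)
    (h₂ : IndepFun Y Z Pr) : IndepFun (fun ω => (X ω, Y ω)) Z Pr := by
  have hXY : IndepFun X Y Pr := h₁.comp measurable_id measurable_fst
  have := Measure.isProbabilityMeasure_map (μ := Pr) hX.aemeasurable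
  have := Measure.isProbabilityMeasure_map (μ := Pr) hY.aemeasurable
  have := Measure.isProbabilityMeasure_map (μ := Pr) hZ.aemeasurable
  rw [indepFun_iff_map_prod_eq_prod_map_map (by fun_prop) (by fun_prop)] at h₁ h₂ hXY ⊢
  rw [hXY, ← (measurePreserving_prodAssoc (Pr.map X) (Pr.map Y) (Pr.map Z)).symm.map_eq, ← h₂,
    ← h₁, Measure.map_map (MeasurableEquiv.measurable _) (by fun_prop)]
  rfl

/-- A recursively defined process is measurable and independent of the future noise. -/
theorem measurable_and_indepFun_tail {𝓧 𝓦 : Type*} [MeasurableSpace 𝓧] [MeasurableSpace 𝓦]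
    {W : ℕ → Ω → 𝓦} (hWm : ∀ k, Measurable (W k)) (hW : iIndepFun W Pr) {g : 𝓧 × 𝓦 → 𝓧}
    (hg : Measurable g) {X : ℕ → Ω → 𝓧} (hX0 : Measurable (X 0))
    (hX0W : IndepFun (X 0) (fun ω k => W k ω) Pr)
    (hX : ∀ k ω, X (k + 1) ω = g (X k ω, W k ω)) (k : ℕ) :
    Measurable (X k) ∧ IndepFun (X k) (fun ω j => W (k + j) ω) Pr := by
  induction k with
  | zero => simpa using ⟨hX0, hX0W⟩
  | succ k ih =>
    obtain ⟨hm, hi⟩ := ih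
    have hXk : X (k + 1) = fun ω => g (X k ω, W k ω) := funext (hX k)
    -- The induction carries independence of the whole noise tail; independence of `W k` alone would
    -- not propagate.
    have hsplit : IndepFun (X k) (fun ω => (W k ω, fun j => W (k + 1 + j) ω)) Pr := by
      have hs : Measurable fun w : ℕ → 𝓦 => (w 0, fun j => w (1 + j)) := by fun_prop
      have := hi.comp (φ := id) measurable_id hs
      simpa only [Function.comp_def, id, add_zero, ← add_assoc] using this
    have h := indepFun_prodMk_of_indepFun hm (hWm k)
      (measurable_pi_lambda _ fun j => hWm (k + 1 + j)) hsplit (indepFun_tail hWm hW k)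
    rw [hXk]
    exact ⟨hg.comp (hm.prodMk (hWm k)), h.comp hg measurable_id⟩

theorem indepFun_noise_of_recursion {𝓧 𝓦 : Type*} [MeasurableSpace 𝓧] [MeasurableSpace 𝓦]
    {W : ℕ → Ω → 𝓦} (hWm : ∀ k, Measurable (W k)) (hW : iIndepFun W Pr) {g : 𝓧 × 𝓦 → 𝓧}
    (hg : Measurable g) {X : ℕ → Ω → 𝓧} (hX0 : Measurable (X 0))
    (hX0W : IndepFun (X 0) (fun ω k => W k ω) Pr)
    (hX : ∀ k ω, X (k + 1) ω = g (X k ω, W k ω)) (k : ℕ) : IndepFun (X k) (W k) Pr := by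
  have h := (measurable_and_indepFun_tail hWm hW hg hX0 hX0W hX k).2
  exact h.comp measurable_id (measurable_pi_apply 0)

/-- An invariant initial law is propagated by the recursion. -/
theorem hasLaw_of_recursion {𝓧 𝓦 : Type*} [MeasurableSpace 𝓧] [MeasurableSpace 𝓦]
    {W : ℕ → Ω → 𝓦} (hWm : ∀ k, Measurable (W k)) (hW : iIndepFun W Pr)
    (hWid : ∀ k, IdentDistrib (W k) (W 0) Pr Pr) {g : 𝓧 × 𝓦 → 𝓧}
    (hg : Measurable g) {X : ℕ → Ω → 𝓧} (hX0 : Measurable (X 0))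
    (hX0W : IndepFun (X 0) (fun ω k => W k ω) Pr)
    (hX : ∀ k ω, X (k + 1) ω = g (X k ω, W k ω)) {ρ : Measure 𝓧}
    (hρ : (ρ.prod (Pr.map (W 0))).map g = ρ) (hlaw : HasLaw (X 0) ρ Pr) (k : ℕ) :
    HasLaw (X k) ρ Pr := by
  induction k with
  | zero => exact hlaw
  | succ k ih =>
    have hi := indepFun_noise_of_recursion hWm hW hg hX0 hX0W hX k
    have hm := (measurable_and_indepFun_tail hWm hW hg hX0 hX0W hX k).1
    refine ⟨(measurable_and_indepFun_tail hWm hW hg hX0 hX0W hX (k + 1)).1.aemeasurable, ?_⟩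
    rw [indepFun_iff_map_prod_eq_prod_map_map hm.aemeasurable (hWm k).aemeasurable,
      ih.map_eq, (hWid k).map_eq] at hi
    rw [funext (hX k), ← hρ, ← hi, Measure.map_map hg (hm.prodMk (hWm k))]
    rfl

end Independence

/-! ### An invariant law as the law of an L² series. -/

section InvariantMeasure

variable {Ω : Type*} [MeasurableSpace Ω] {Pr : Measure Ω} {n : ℕ}

theorem memLp_mv {a b : ℕ} (M : Matrix (Fin a) (Fin b) ℝ) {X : Ω → Vec b} {p : ENNReal}
    {μ : Measure Ω} (hX : MemLp X p μ) : MemLp (fun ω => mv M (X ω)) p μ :=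
  (mvL M).comp_memLp' hX

theorem charFun_map_mv {a b : ℕ} (M : Matrix (Fin a) (Fin b) ℝ) (μ : Measure (Vec b)) (t : Vec a) :
    charFun (μ.map (mv M)) t = charFun μ (mv Mᵀ t) := by
  simp only [charFun_apply]
  rw [integral_map (by fun_prop) (by fun_prop)]
  refine integral_congr_ae (Filter.Eventually.of_forall fun x => ?_)
  simp only
  rw [real_inner_comm, inner_mv, real_inner_comm]

/-- The partial sums of `∑ Mᵏ G(k)`. -/
noncomputable def partialSum {Ω : Type*} (M : Matrix (Fin n) (Fin n) ℝ) (G : ℕ → Ω → Vec n) (N : ℕ) :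
    Ω → Vec n :=
  ∑ k ∈ Finset.range N, fun ω => mv (M ^ k) (G k ω)

theorem partialSum_succ {Ω : Type*} (M : Matrix (Fin n) (Fin n) ℝ) (G : ℕ → Ω → Vec n) (N : ℕ) :
    partialSum M G (N + 1) = partialSum M G N + fun ω => mv (M ^ N) (G N ω) :=
  Finset.sum_range_succ _ _

theorem measurable_partialSum (M : Matrix (Fin n) (Fin n) ℝ) {G : ℕ → Ω → Vec n}
    (hG : ∀ k, Measurable (G k)) (N : ℕ) : Measurable (partialSum M G N) := by
  have h : ∀ k, Measurable fun ω => mv (M ^ k) (G k ω) := fun k => (measurable_mv _).comp (hG k)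
  induction N with
  | zero => exact measurable_const
  | succ N ih => rw [partialSum_succ]; exact ih.add (h N)

theorem memLp_partialSum (M : Matrix (Fin n) (Fin n) ℝ) {G : ℕ → Ω → Vec n}
    (hG : ∀ k, MemLp (G k) 2 Pr) (N : ℕ) : MemLp (partialSum M G N) 2 Pr :=
  memLp_finsetSum' _ fun k _ => memLp_mv _ (hG k)

theorem charFun_partialSum [IsProbabilityMeasure Pr] (M : Matrix (Fin n) (Fin n) ℝ) {G : ℕ → Ω → Vec n}
    (hGm : ∀ k, Measurable (G k)) (hG : iIndepFun G Pr)
    (hGid : ∀ k, IdentDistrib (G k) (G 0) Pr Pr) (N : ℕ) (t : Vec n) :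
    charFun (Pr.map (partialSum M G N)) t
      = ∏ k ∈ Finset.range N, charFun (Pr.map (G 0)) (mv (M ^ k)ᵀ t) := by
  induction N with
  | zero =>
    have h : partialSum M G 0 = fun _ => 0 := rfl
    simp [h, charFun_dirac]
  | succ N ih =>
    have hmN : Measurable fun ω => mv (M ^ N) (G N ω) := (measurable_mv _).comp (hGm N)
    have hi : IndepFun (partialSum M G N) (fun ω => mv (M ^ N) (G N ω)) Pr :=
      (hG.comp (fun k => mv (M ^ k)) fun k => measurable_mv _).indepFun_sum_range_succ
        (fun k => (measurable_mv _).comp (hGm k)) N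
    rw [partialSum_succ, hi.charFun_map_add_eq_mul (measurable_partialSum M hGm N).aemeasurable
      (hmN.aemeasurable), Pi.mul_apply, ih, Finset.prod_range_succ,
      ← (hGid N).map_eq, ← charFun_map_mv, Measure.map_map (by fun_prop) (hGm N),
      (hGid N).map_eq]
    rfl

/-- The terms G(k) share one L² norm, so the increments decay geometrically and the partial sums are
Cauchy in L². -/
theorem exists_tendsto_partialSum {M : Matrix (Fin n) (Fin n) ℝ} {C r : ℝ} (hr : r < 1)
    (hM : ∀ k x, ‖mv (M ^ k) x‖ ≤ C * r ^ k * ‖x‖)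
    {G : ℕ → Ω → Vec n} (hG2 : ∀ k, MemLp (G k) 2 Pr)
    (hGid : ∀ k, IdentDistrib (G k) (G 0) Pr Pr) :
    ∃ Y : Ω → Vec n, MemLp Y 2 Pr ∧ TendstoInMeasure Pr (partialSum M G) Filter.atTop Y := by
  have hcs : CauchySeq fun N => (memLp_partialSum M hG2 N).toLp (partialSum M G N) := by
    refine cauchySeq_of_le_geometric r (C * ‖(hG2 0).toLp (G 0)‖) hr fun N => ?_
    rw [dist_comm, dist_eq_norm, ← MemLp.toLp_sub]
    have h1 : ‖(hG2 N).toLp (G N)‖ = ‖(hG2 0).toLp (G 0)‖ := by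
      rw [Lp.norm_toLp, Lp.norm_toLp, (hGid N).eLpNorm_eq]
    rw [← h1, mul_right_comm]
    refine Lp.norm_le_mul_norm_of_ae_le_mul ?_
    filter_upwards [MemLp.coeFn_toLp
      ((memLp_partialSum M hG2 (N + 1)).sub (memLp_partialSum M hG2 N)),
      MemLp.coeFn_toLp (hG2 N)] with ω h2 h3
    rw [h2, h3, partialSum_succ, add_sub_cancel_left]
    exact hM N _
  obtain ⟨Y, hY⟩ := cauchySeq_tendsto_of_complete hcs
  refine ⟨Y, Lp.memLp Y, ?_⟩
  exact (tendstoInMeasure_of_tendsto_Lp hY).congr_left fun N => MemLp.coeFn_toLp _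

/-- Existence of an invariant law with finite second moment for `X⁺ = M X + G`, when the powers of
`M` decay exponentially. -/
theorem exists_invariant_measure [IsProbabilityMeasure Pr] {M : Matrix (Fin n) (Fin n) ℝ} {C r : ℝ} (hr : r < 1)
    (hM : ∀ k x, ‖mv (M ^ k) x‖ ≤ C * r ^ k * ‖x‖)
    {G : ℕ → Ω → Vec n} (hGm : ∀ k, Measurable (G k)) (hG2 : ∀ k, MemLp (G k) 2 Pr)
    (hG : iIndepFun G Pr) (hGid : ∀ k, IdentDistrib (G k) (G 0) Pr Pr) :
    ∃ ρ : Measure (Vec n), IsProbabilityMeasure ρ ∧ MemLp id 2 ρ ∧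
      (ρ.prod (Pr.map (G 0))).map (fun p => mv M p.1 + p.2) = ρ := by
  obtain ⟨Y, hY2, hY⟩ := exists_tendsto_partialSum hr hM hG2 hGid
  have hYm : AEMeasurable Y Pr := hY2.1.aemeasurable
  have hρ := Measure.isProbabilityMeasure_map hYm
  have hν := Measure.isProbabilityMeasure_map (μ := Pr) (hGm 0).aemeasurable
  have hlim : ∀ t, Filter.Tendsto
      (fun N => ∏ k ∈ Finset.range N, charFun (Pr.map (G 0)) (mv (M ^ k)ᵀ t)) Filter.atTop
      (nhds (charFun (Pr.map Y) t)) := by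
    intro t
    have h1 := (hY.tendstoInDistribution
      (fun N => (measurable_partialSum M hGm N).aemeasurable)).tendsto
    have h2 := ProbabilityMeasure.tendsto_iff_tendsto_charFun.1 h1 t
    simpa only [ProbabilityMeasure.coe_mk, charFun_partialSum M hGm hG hGid] using h2
  refine ⟨Pr.map Y, hρ, ?_, ?_⟩
  · rw [memLp_map_measure_iff (by fun_prop) hYm]
    exact hY2
  · have hm : Measurable fun p : Vec n × Vec n => mv M p.1 + p.2 := by fun_prop
    have hprob : IsProbabilityMeasure (((Pr.map Y).prod (Pr.map (G 0))).map
        (fun p => mv M p.1 + p.2)) := Measure.isProbabilityMeasure_map hm.aemeasurable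
    refine Measure.ext_of_charFun (funext fun t => ?_)
    have hsplit : charFun (((Pr.map Y).prod (Pr.map (G 0))).map (fun p => mv M p.1 + p.2)) t
        = charFun (Pr.map Y) (mv Mᵀ t) * charFun (Pr.map (G 0)) t := by
      rw [← charFun_map_mv]
      have := Measure.isProbabilityMeasure_map (μ := Pr.map Y) (measurable_mv M).aemeasurable
      rw [← Pi.mul_apply, ← charFun_map_add_prod_eq_mul]
      congr 1
      have : (Measure.map (mv M) (Pr.map Y)).prod (Pr.map (G 0))
          = ((Pr.map Y).prod (Pr.map (G 0))).map (Prod.map (mv M) id) := by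
        rw [← Measure.map_prod_map _ _ (by fun_prop) measurable_id, Measure.map_id]
      rw [this, Measure.map_map (by fun_prop) (by fun_prop)]
      rfl
    rw [hsplit]
    -- Both sides are limits of the same characteristic-function product: applying Mᵀ shifts its
    -- index by one, and the extra factor is the term k = 0.
    refine tendsto_nhds_unique ((hlim (mv Mᵀ t)).mul_const _) ?_
    have h := (hlim t).comp (Filter.tendsto_add_atTop_nat 1)
    refine h.congr fun N => ?_
    simp only [Function.comp_def]
    rw [Finset.prod_range_succ', pow_zero, Matrix.transpose_one, one_mv]
    congr 1
    refine Finset.prod_congr rfl fun k _ => ?_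
    rw [pow_succ', Matrix.transpose_mul, mul_mv]

end InvariantMeasure

/-! ### Moments, covariances and mean-variance costs. -/

section SquareIntegrable

variable {Ω : Type*} [MeasurableSpace Ω] {Pr : Measure Ω} {d : ℕ}

theorem integrable_norm_sq {X : Ω → Vec d} (hX : MemLp X 2 Pr) :
    Integrable (fun ω => ‖X ω‖ ^ 2) Pr :=
  hX.integrable_norm_pow two_ne_zero

theorem integrable_inner_of_memLp {X Y : Ω → Vec d} (hX : MemLp X 2 Pr) (hY : MemLp Y 2 Pr) :
    Integrable (fun ω => inner ℝ (X ω) (Y ω)) Pr := by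
  refine ((integrable_norm_sq hX).add (integrable_norm_sq hY)).mono' (hX.1.inner hY.1)
    (Filter.Eventually.of_forall fun ω => ?_)
  have := norm_inner_le_norm (𝕜 := ℝ) (X ω) (Y ω)
  simp only [Pi.add_apply]
  nlinarith [sq_nonneg (‖X ω‖ - ‖Y ω‖), sq_nonneg ‖X ω‖, sq_nonneg ‖Y ω‖]

theorem integrable_inner_mv {a b : ℕ} (M : Matrix (Fin a) (Fin b) ℝ) {X : Ω → Vec a}
    {Y : Ω → Vec b} (hX : MemLp X 2 Pr) (hY : MemLp Y 2 Pr) :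
    Integrable (fun ω => inner ℝ (X ω) (mv M (Y ω))) Pr :=
  integrable_inner_of_memLp hX (memLp_mv M hY)

theorem integrable_qf (M : Matrix (Fin d) (Fin d) ℝ) {X : Ω → Vec d} (hX : MemLp X 2 Pr) :
    Integrable (fun ω => qf M (X ω)) Pr :=
  integrable_inner_mv M hX hX

theorem memLp_apply {X : Ω → Vec d} (hX : MemLp X 2 Pr) (i : Fin d) :
    MemLp (fun ω => X ω i) 2 Pr :=
  (EuclideanSpace.proj (𝕜 := ℝ) i).comp_memLp' hX

theorem norm_toLp_eq_sqrt {X : Ω → Vec d} (hX : MemLp X 2 Pr) :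
    ‖hX.toLp X‖ = √(∫ ω, ‖X ω‖ ^ 2 ∂Pr) := by
  refine (Real.sqrt_eq_iff_mul_self_eq (integral_nonneg fun ω => by positivity)
    (norm_nonneg _)).2 ?_ |>.symm
  rw [← real_inner_self_eq_norm_mul_norm, L2.inner_def]
  refine integral_congr_ae ?_
  filter_upwards [hX.coeFn_toLp] with ω hω
  rw [hω, real_inner_self_eq_norm_sq]

variable [IsProbabilityMeasure Pr]

theorem integrable_of_memLp_two {X : Ω → Vec d} (hX : MemLp X 2 Pr) : Integrable X Pr :=
  hX.integrable one_le_two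

theorem integrable_inner_const_left (s : Vec d) {X : Ω → Vec d} (hX : MemLp X 2 Pr) :
    Integrable (fun ω => inner ℝ s (X ω)) Pr :=
  (integrable_of_memLp_two hX).const_inner s

theorem memLp_sub_const {X : Ω → Vec d} (hX : MemLp X 2 Pr) (a : Vec d) :
    MemLp (fun ω => X ω - a) 2 Pr :=
  hX.sub (memLp_const a)

theorem integral_inner_const_left (s : Vec d) {X : Ω → Vec d} (hX : MemLp X 2 Pr) :
    ∫ ω, inner ℝ s (X ω) ∂Pr = inner ℝ s (∫ ω, X ω ∂Pr) :=
  integral_inner (integrable_of_memLp_two hX) s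

theorem integral_mv {a b : ℕ} (M : Matrix (Fin a) (Fin b) ℝ) {X : Ω → Vec b}
    (hX : MemLp X 2 Pr) : ∫ ω, mv M (X ω) ∂Pr = mv M (∫ ω, X ω ∂Pr) :=
  (mvL M).integral_comp_comm (integrable_of_memLp_two hX)

theorem integral_vec_apply {X : Ω → Vec d} (hX : MemLp X 2 Pr) (i : Fin d) :
    (∫ ω, X ω ∂Pr) i = ∫ ω, X ω i ∂Pr :=
  ((EuclideanSpace.proj (𝕜 := ℝ) i).integral_comp_comm (integrable_of_memLp_two hX)).symm

theorem integral_sub_mean {X : Ω → Vec d} (hX : MemLp X 2 Pr) {a : Vec d}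
    (ha : ∫ ω, X ω ∂Pr = a) : ∫ ω, (X ω - a) ∂Pr = 0 := by
  rw [integral_sub (integrable_of_memLp_two hX) (integrable_const _), ha]
  simp

theorem trace_mul_covMat (Q : Matrix (Fin d) (Fin d) ℝ) {X : Ω → Vec d} (hX : MemLp X 2 Pr) :
    (Q * covMat Pr X).trace = ∫ ω, qf Q (X ω - ∫ ω', X ω' ∂Pr) ∂Pr := by
  have hsq : ∀ i j, Integrable (fun ω => (X ω j - ∫ ω', X ω' j ∂Pr) * (X ω i - ∫ ω', X ω' i ∂Pr))
      Pr := fun i j =>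
    ((memLp_apply hX j).sub (memLp_const _)).integrable_mul
      ((memLp_apply hX i).sub (memLp_const _))
  have hqf : ∀ ω, qf Q (X ω - ∫ ω', X ω' ∂Pr) = ∑ i, ∑ j, Q i j *
      ((X ω j - ∫ ω', X ω' j ∂Pr) * (X ω i - ∫ ω', X ω' i ∂Pr)) := by
    intro ω
    simp only [qf, inner_eq_sum, mv_apply, PiLp.sub_apply, integral_vec_apply hX, Finset.mul_sum]
    exact Finset.sum_congr rfl fun i _ => Finset.sum_congr rfl fun j _ => by ring
  have hI : ∀ i j, Integrable (fun ω => Q i j *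
      ((X ω j - ∫ ω', X ω' j ∂Pr) * (X ω i - ∫ ω', X ω' i ∂Pr))) Pr :=
    fun i j => (hsq i j).const_mul _
  rw [integral_congr_ae (Filter.Eventually.of_forall hqf),
    integral_finsetSum _ fun i _ => integrable_finsetSum _ fun j _ => hI i j]
  refine Finset.sum_congr rfl fun i _ => ?_
  rw [integral_finsetSum _ fun j _ => hI i j, Matrix.diag_apply, Matrix.mul_apply]
  refine Finset.sum_congr rfl fun j _ => ?_
  rw [integral_const_mul, covMat, Matrix.of_apply, covariance]

theorem trace_covMat {X : Ω → Vec d} (hX : MemLp X 2 Pr) :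
    (covMat Pr X).trace = ∫ ω, ‖X ω - ∫ ω', X ω' ∂Pr‖ ^ 2 ∂Pr := by
  rw [← one_mul (covMat Pr X), trace_mul_covMat 1 hX]
  simp only [qf_one]

theorem integral_inner_of_indepFun {X Y : Ω → Vec d} (hX : MemLp X 2 Pr) (hY : MemLp Y 2 Pr)
    (h : IndepFun X Y Pr) :
    ∫ ω, inner ℝ (X ω) (Y ω) ∂Pr = inner ℝ (∫ ω, X ω ∂Pr) (∫ ω, Y ω ∂Pr) := by
  have hi : ∀ i, IndepFun (fun ω => X ω i) (fun ω => Y ω i) Pr := fun i =>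
    h.comp (φ := fun x : Vec d => x i) (ψ := fun x : Vec d => x i) (by fun_prop) (by fun_prop)
  have hI : ∀ i, Integrable (fun ω => X ω i * Y ω i) Pr := fun i =>
    (memLp_apply hX i).integrable_mul (memLp_apply hY i)
  simp only [inner_eq_sum, integral_vec_apply hX, integral_vec_apply hY]
  rw [integral_finsetSum _ fun i _ => hI i]
  exact Finset.sum_congr rfl fun i _ => (hi i).integral_mul_eq_mul_integral
    (memLp_apply hX i).1 (memLp_apply hY i).1

/-- Mean-variance decomposition. Applied to a difference X − Y it yields both moment estimates
below, by dropping one summand. -/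
theorem integral_norm_sq_eq {X : Ω → Vec d} (hX : MemLp X 2 Pr) :
    ∫ ω, ‖X ω‖ ^ 2 ∂Pr
      = ‖∫ ω, X ω ∂Pr‖ ^ 2 + ∫ ω, ‖X ω - ∫ ω', X ω' ∂Pr‖ ^ 2 ∂Pr := by
  set a := ∫ ω, X ω ∂Pr with ha
  have hpt : ∀ ω, ‖X ω - a‖ ^ 2 = ‖X ω‖ ^ 2 - 2 * inner ℝ a (X ω) + ‖a‖ ^ 2 := fun ω => by
    rw [norm_sub_sq_real, real_inner_comm]
  have hi := integrable_inner_const_left a hX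
  simp only [hpt]
  rw [integral_add ((integrable_norm_sq hX).sub' (hi.const_mul 2)) (integrable_const _),
    integral_sub (integrable_norm_sq hX) (hi.const_mul 2), integral_const_mul,
    integral_inner_const_left a hX, ← ha, real_inner_self_eq_norm_sq]
  simp
  ring

/-- The distance of the means is bounded by the `L²` distance. -/
theorem norm_integral_sub_sq_le {X Y : Ω → Vec d} (hX : MemLp X 2 Pr) (hY : MemLp Y 2 Pr) :
    ‖(∫ ω, X ω ∂Pr) - ∫ ω, Y ω ∂Pr‖ ^ 2 ≤ ∫ ω, ‖X ω - Y ω‖ ^ 2 ∂Pr := by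
  have h : MemLp (fun ω => X ω - Y ω) 2 Pr := hX.sub hY
  rw [integral_norm_sq_eq h, integral_sub (integrable_of_memLp_two hX) (integrable_of_memLp_two hY)]
  exact le_add_of_nonneg_right (integral_nonneg fun ω => by positivity)

/-- The distance of the standard deviations is bounded by the `L²` distance. -/
theorem abs_sqrt_trace_covMat_sub_sq_le {X Y : Ω → Vec d} (hX : MemLp X 2 Pr)
    (hY : MemLp Y 2 Pr) :
    |√((covMat Pr X).trace) - √((covMat Pr Y).trace)| ^ 2 ≤ ∫ ω, ‖X ω - Y ω‖ ^ 2 ∂Pr := by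
  have hX' := memLp_sub_const hX (∫ ω, X ω ∂Pr)
  have hY' := memLp_sub_const hY (∫ ω, Y ω ∂Pr)
  have h : MemLp (fun ω => X ω - Y ω) 2 Pr := hX.sub hY
  -- A standard deviation is the L² norm of the centred variable, so this is the reverse triangle
  -- inequality.
  have h1 := abs_norm_sub_norm_le (hX'.toLp _) (hY'.toLp _)
  rw [← MemLp.toLp_sub, norm_toLp_eq_sqrt, norm_toLp_eq_sqrt, norm_toLp_eq_sqrt,
    ← trace_covMat hX, ← trace_covMat hY] at h1
  have h2 := pow_le_pow_left₀ (abs_nonneg _) h1 2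
  rw [Real.sq_sqrt (integral_nonneg fun ω => by positivity)] at h2
  refine h2.trans ?_
  rw [integral_norm_sq_eq h, integral_sub (integrable_of_memLp_two hX) (integrable_of_memLp_two hY)]
  refine le_add_of_nonneg_of_le (by positivity) (le_of_eq ?_)
  refine integral_congr_ae (Filter.Eventually.of_forall fun ω => ?_)
  simp only [Pi.sub_apply]
  congr 2
  abel

/-- Lower bound for the excess of a mean-variance cost over its value at `Y`. -/
theorem integral_le_meanVarianceCost_sub {Q₁ Q₂ : Matrix (Fin d) (Fin d) ℝ} (hQ₁ : Q₁ᵀ = Q₁)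
    (hQ₂ : Q₂.PosSemidef) (s : Vec d) {X Y : Ω → Vec d} (hX : MemLp X 2 Pr) (hY : MemLp Y 2 Pr)
    {y : Vec d} (hy : ∫ ω, Y ω ∂Pr = y) :
    ∫ ω, (qf Q₁ (X ω - Y ω) + 2 * inner ℝ (X ω - Y ω) (mv Q₁ y)
        + 2 * inner ℝ (X ω - Y ω) (mv (Q₁ + Q₂) (Y ω - y)) + inner ℝ s (X ω - Y ω)) ∂Pr
      ≤ (∫ ω, (qf Q₁ (X ω) + inner ℝ s (X ω)) ∂Pr + (Q₂ * covMat Pr X).trace)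
        - (∫ ω, (qf Q₁ (Y ω) + inner ℝ s (Y ω)) ∂Pr + (Q₂ * covMat Pr Y).trace) := by
  have hD : MemLp (fun ω => X ω - Y ω) 2 Pr := hX.sub hY
  have hZ := memLp_sub_const hY y
  set a := ∫ ω, X ω ∂Pr with ha
  have hXa := memLp_sub_const hX a
  -- Adding this zero-mean term makes the inequality hold pointwise; the only quantity discarded is
  -- the `Q₂`-form of the centred difference.
  have hzero : ∫ ω, inner ℝ (a - y) (mv Q₂ (Y ω - y)) ∂Pr = 0 := by
    rw [integral_inner_const_left _ (memLp_mv _ hZ), integral_mv _ hZ, integral_sub_mean hY hy,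
      mv_zero, inner_zero_right]
  rw [trace_mul_covMat _ hX, trace_mul_covMat _ hY, hy, ← ha]
  have i1 := (integrable_qf Q₁ hX).fun_add (integrable_inner_const_left s hX)
  have i2 := (integrable_qf Q₁ hY).fun_add (integrable_inner_const_left s hY)
  have i3 := integrable_qf Q₂ hXa
  have i4 := integrable_qf Q₂ hZ
  have i5 := (integrable_inner_const_left (a - y) (memLp_mv Q₂ hZ)).const_mul 2
  have hR : (∫ ω, (qf Q₁ (X ω) + inner ℝ s (X ω)) ∂Pr + ∫ ω, qf Q₂ (X ω - a) ∂Pr)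
        - (∫ ω, (qf Q₁ (Y ω) + inner ℝ s (Y ω)) ∂Pr + ∫ ω, qf Q₂ (Y ω - y) ∂Pr)
      = ∫ ω, ((((qf Q₁ (X ω) + inner ℝ s (X ω)) + qf Q₂ (X ω - a))
        - ((qf Q₁ (Y ω) + inner ℝ s (Y ω)) + qf Q₂ (Y ω - y)))
        + 2 * inner ℝ (a - y) (mv Q₂ (Y ω - y))) ∂Pr := by
    rw [integral_add ((i1.fun_add i3).sub' (i2.fun_add i4)) i5, integral_sub (i1.fun_add i3) (i2.fun_add i4),
      integral_add i1 i3, integral_add i2 i4, integral_const_mul, hzero]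
    ring
  rw [hR]
  refine integral_mono ?_ (((i1.fun_add i3).sub' (i2.fun_add i4)).fun_add i5) fun ω => ?_
  · exact (((integrable_qf Q₁ hD).add
      ((integrable_inner_of_memLp hD (memLp_const _)).const_mul 2)).add
      ((integrable_inner_mv _ hD hZ).const_mul 2)).add (integrable_inner_const_left s hD)
  · have e1 : qf Q₁ (X ω) = qf Q₁ (X ω - Y ω) + 2 * inner ℝ (X ω - Y ω) (mv Q₁ (Y ω))
        + qf Q₁ (Y ω) := by
      rw [← qf_add hQ₁, sub_add_cancel]
    have e2 : qf Q₂ (X ω - a) = qf Q₂ (X ω - Y ω - (a - y))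
        + 2 * inner ℝ (X ω - Y ω - (a - y)) (mv Q₂ (Y ω - y)) + qf Q₂ (Y ω - y) := by
      rw [← qf_add (PosSemidef.transpose_eq hQ₂)]; congr 1; abel
    have e3 : mv (Q₁ + Q₂) (Y ω - y) = mv Q₁ (Y ω) - mv Q₁ y + mv Q₂ (Y ω - y) := by
      rw [add_mv, mv_sub Q₁]
    have h4 := PosSemidef.qf_nonneg hQ₂ (X ω - Y ω - (a - y))
    rw [e1, e2, e3, inner_sub_left (X ω - Y ω) (a - y), inner_add_right, inner_sub_right,
      inner_sub_right s]
    linarith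

end SquareIntegrable

/-! ### The dissipation inequality, pointwise and in expectation. -/

section Dissipativity

variable {n l m : ℕ} {D : Data n l m}

theorem f_sub_f (x x' : Vec n) (u u' : Vec l) (w : Vec m) :
    D.f x u w - D.f x' u' w = mv D.A (x - x') + mv D.B (u - u') := by
  simp only [Data.f, mv_sub]; abel

theorem feedback_eq (P : Matrix (Fin n) (Fin n) ℝ) (xs xt : Vec n) (us ut : Vec l) (x : Vec n) :
    D.feedback P xs xt us ut x = mv (D.gain P) (x - (xs + xt)) + (us + ut) := by
  rw [Data.feedback, sub_sub, add_comm xt xs]; abel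

@[fun_prop]
theorem measurable_feedback (P : Matrix (Fin n) (Fin n) ℝ) (xs xt : Vec n) (us ut : Vec l) :
    Measurable (D.feedback P xs xt us ut) := by
  unfold Data.feedback; fun_prop

/-- The two steady-state equations remove all affine terms, so deviations obey a linear recursion
driven by the noise centred at μ. -/
theorem f_feedback_sub {P : Matrix (Fin n) (Fin n) ℝ} {xs xt : Vec n} {us ut : Vec l} {μ : Vec m}
    (hss : xs - mv D.A xs - mv D.B us = mv D.E μ + D.z)
    (ht : xt - mv D.A xt - mv D.B ut = 0) (x : Vec n) (w : Vec m) :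
    D.f x (D.feedback P xs xt us ut x) w - (xs + xt)
      = mv (D.closedLoop P) (x - (xs + xt)) + mv D.E (w - μ) := by
  have hz : D.z = xs - mv D.A xs - mv D.B us - mv D.E μ := by rw [hss]; abel
  have hut : mv D.B ut = xt - mv D.A xt := (sub_eq_zero.mp ht).symm
  rw [feedback_eq, Data.f, closedLoop_mv, hz]
  simp only [mv_add, mv_sub, hut]
  abel

/-- The integrand of the storage function. -/
noncomputable def storageIntegrand (P S : Matrix (Fin n) (Fin n) ℝ) (q xs xt x y : Vec n) : ℝ :=
  qf (P + S) (x - (y - xt)) - qf P (x - xs) + inner ℝ q (x - (y - xt))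

/-- The P-terms quadratic in the displacement cancel, leaving one cross term with the deviation of y
and a term in y alone. -/
theorem storageIntegrand_eq {P : Matrix (Fin n) (Fin n) ℝ} (hP : Pᵀ = P)
    (S : Matrix (Fin n) (Fin n) ℝ) (q xs xt x y : Vec n) :
    storageIntegrand P S q xs xt x y = qf S (x - y + xt)
      - 2 * inner ℝ (x - y + xt) (mv P (y - (xs + xt))) - qf P (y - (xs + xt))
      + inner ℝ q (x - y + xt) := by
  have e1 : x - (y - xt) = x - y + xt := by abel
  have e2 : x - xs = (x - y + xt) + (y - (xs + xt)) := by abel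
  rw [storageIntegrand, e1, e2, qf_add_matrix, qf_add hP (x - y + xt) (y - (xs + xt))]
  ring

/-- The pointwise dissipation inequality; the terms after the storage integrands are those whose
contributions vanish in expectation. -/
theorem pointwise_dissipation (hR₁ : D.R₁.PosDef) (hR₂ : D.R₂.PosSemidef)
    {P S : Matrix (Fin n) (Fin n) ℝ} (hP : D.IsRiccatiSolution P) (hS : S.PosDef) {c : ℝ}
    (h : ∀ x u, c * ‖x‖ ^ 2 ≤
      qf D.Q₁ x + qf D.R₁ u + qf S x - qf S (mv D.A x + mv D.B u))
    {xs xt q : Vec n} {us ut : Vec l} {μ : Vec m}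
    (hss : xs - mv D.A xs - mv D.B us = mv D.E μ + D.z)
    (ht : xt - mv D.A xt - mv D.B ut = 0)
    (hopt : ∀ x u, 2 * inner ℝ x (mv D.Q₁ (xs + xt)) + inner ℝ D.s x
        + (2 * inner ℝ u (mv D.R₁ (us + ut)) + inner ℝ D.v u)
        + inner ℝ q (x - mv D.A x - mv D.B u) = 0)
    (x y : Vec n) (u u' : Vec l) (hu' : u' = D.feedback P xs xt us ut y) (w : Vec m) :
    c * ‖x - y‖ ^ 2 ≤
      (qf D.Q₁ (x - y) + 2 * inner ℝ (x - y) (mv D.Q₁ (xs + xt))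
        + 2 * inner ℝ (x - y) (mv (D.Q₁ + D.Q₂) (y - (xs + xt))) + inner ℝ D.s (x - y))
      + (qf D.R₁ (u - u') + 2 * inner ℝ (u - u') (mv D.R₁ (us + ut))
        + 2 * inner ℝ (u - u') (mv (D.R₁ + D.R₂) (u' - (us + ut))) + inner ℝ D.v (u - u'))
      + storageIntegrand P S (q - (2 : ℝ) • mv S xt) xs xt x y
      - storageIntegrand P S (q - (2 : ℝ) • mv S xt) xs xt (D.f x u w) (D.f y u' w)
      + 2 * inner ℝ xt (mv P (y - (xs + xt)))
      - 2 * inner ℝ xt (mv P (D.f y u' w - (xs + xt)))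
      + qf P (y - (xs + xt)) - qf P (D.f y u' w - (xs + xt))
      - 2 * inner ℝ (D.f x u w - D.f y u' w) (mv P (mv D.E (w - μ))) := by
  have hPt := PosSemidef.transpose_eq hP.1
  have hSt := PosSemidef.transpose_eq hS.posSemidef
  have hZ : D.f y u' w - (xs + xt)
      = mv (D.closedLoop P) (y - (xs + xt)) + mv D.E (w - μ) := by
    rw [hu']; exact f_feedback_sub hss ht y w
  have hK : u' - (us + ut) = mv (D.gain P) (y - (xs + xt)) := by
    rw [hu', feedback_eq, add_sub_cancel_right]
  rw [storageIntegrand_eq hPt, storageIntegrand_eq hPt, f_sub_f, hZ, hK]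
  set d := x - y
  set v := u - u'
  set z := y - (xs + xt)
  set e := mv D.E (w - μ)
  set d' := mv D.A d + mv D.B v with hd'
  have h1 := h d v
  have h2 := hopt d v
  have h3 : d - mv D.A d - mv D.B v = d - d' := by rw [hd']; abel
  rw [h3] at h2
  -- `hQ` and `hR` turn the mixed cost terms into a telescoping pair in P that cancels the cross
  -- terms of the storage integrands. The shift of q by 2S`xt` absorbs the cross term from expanding
  -- the S-form at d + `xt`.
  have hQ : inner ℝ d (mv (D.Q₁ + D.Q₂) z)
      = inner ℝ d (mv P z) - inner ℝ (mv D.A d) (mv P (mv (D.closedLoop P) z)) := by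
    have h4 := congrArg (fun y => inner ℝ d y) (riccati_state_relation hP z)
    simp only [inner_add_right] at h4
    rw [inner_mv D.Aᵀ, Matrix.transpose_transpose] at h4
    linarith
  have hR : inner ℝ v (mv (D.R₁ + D.R₂) (mv (D.gain P) z))
      = -inner ℝ (mv D.B v) (mv P (mv (D.closedLoop P) z)) := by
    have h4 := congrArg (fun y => inner ℝ v y) (riccati_input_relation hR₁ hR₂ hP.1 z)
    simp only [inner_add_right, inner_zero_right] at h4
    rw [inner_mv D.Bᵀ, Matrix.transpose_transpose] at h4
    linarith
  have hd'' : inner ℝ d' (mv P (mv (D.closedLoop P) z))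
      = inner ℝ (mv D.A d) (mv P (mv (D.closedLoop P) z))
        + inner ℝ (mv D.B v) (mv P (mv (D.closedLoop P) z)) := by
    rw [hd', inner_add_left]
  have hSd : inner ℝ (mv S xt) d = inner ℝ d (mv S xt) := real_inner_comm _ _
  have hSd' : inner ℝ (mv S xt) d' = inner ℝ d' (mv S xt) := real_inner_comm _ _
  rw [qf_add hSt d xt, qf_add hSt d' xt, hQ, hR, mv_add P]
  simp only [inner_add_left, inner_add_right, inner_sub_left, inner_sub_right,
    real_inner_smul_left] at h2 ⊢
  linarith

/-- A lower bound for the storage integrand that depends on the reference state only. -/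
theorem le_storageIntegrand {P S : Matrix (Fin n) (Fin n) ℝ} (hP : Pᵀ = P) {r : ℝ} (hr : 0 < r)
    (hS : ∀ x, r * ‖x‖ ^ 2 ≤ qf S x) (q xs xt x y : Vec n) :
    -((2 * ‖mvL P‖ * ‖y - (xs + xt)‖ + ‖q‖) ^ 2 / (4 * r) + ‖mvL P‖ * ‖y - (xs + xt)‖ ^ 2)
      ≤ storageIntegrand P S q xs xt x y := by
  rw [storageIntegrand_eq hP]
  set d := x - y + xt
  set z := y - (xs + xt)
  have h1 := hS d
  have h2 : inner ℝ d (mv P z) ≤ ‖d‖ * (‖mvL P‖ * ‖z‖) :=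
    (real_inner_le_norm _ _).trans (by gcongr; exact norm_mv_le _ _)
  have h3 := (le_abs_self _).trans (abs_qf_le P z)
  have h4 := (abs_le.mp (abs_real_inner_le_norm q d)).1
  have h5 : ‖d‖ * (2 * ‖mvL P‖ * ‖z‖ + ‖q‖)
      ≤ r * ‖d‖ ^ 2 + (2 * ‖mvL P‖ * ‖z‖ + ‖q‖) ^ 2 / (4 * r) := by
    set b := 2 * ‖mvL P‖ * ‖z‖ + ‖q‖
    have : r * ‖d‖ ^ 2 + b ^ 2 / (4 * r) - ‖d‖ * b = (2 * r * ‖d‖ - b) ^ 2 / (4 * r) := by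
      field_simp; ring
    have h6 : 0 ≤ (2 * r * ‖d‖ - b) ^ 2 / (4 * r) := by positivity
    linarith
  nlinarith

variable {Ω : Type*} [MeasurableSpace Ω] {Pr : Measure Ω} [IsProbabilityMeasure Pr]

theorem memLp_f {X : Ω → Vec n} {U : Ω → Vec l} {W : Ω → Vec m} (hX : MemLp X 2 Pr)
    (hU : MemLp U 2 Pr) (hW : MemLp W 2 Pr) : MemLp (fun ω => D.f (X ω) (U ω) (W ω)) 2 Pr :=
  (((memLp_mv _ hX).add (memLp_mv _ hU)).add (memLp_mv _ hW)).add (memLp_const _)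

theorem integrable_storageIntegrand (P S : Matrix (Fin n) (Fin n) ℝ) (q xs xt : Vec n)
    {X Y : Ω → Vec n} (hX : MemLp X 2 Pr) (hY : MemLp Y 2 Pr) :
    Integrable (fun ω => storageIntegrand P S q xs xt (X ω) (Y ω)) Pr := by
  have h : MemLp (fun ω => X ω - (Y ω - xt)) 2 Pr := hX.sub (memLp_sub_const hY xt)
  exact ((integrable_qf _ h).sub (integrable_qf _ (memLp_sub_const hX xs))).add
    (integrable_inner_const_left q h)

theorem cost_eq {X : Ω → Vec n} {U : Ω → Vec l} (hX : MemLp X 2 Pr) (hU : MemLp U 2 Pr) :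
    D.cost Pr X U
      = ((∫ ω, (qf D.Q₁ (X ω) + inner ℝ D.s (X ω)) ∂Pr) + (D.Q₂ * covMat Pr X).trace)
        + ((∫ ω, (qf D.R₁ (U ω) + inner ℝ D.v (U ω)) ∂Pr) + (D.R₂ * covMat Pr U).trace) + D.c := by
  have i1 := (integrable_qf D.Q₁ hX).fun_add (integrable_inner_const_left D.s hX)
  have i2 := (integrable_qf D.R₁ hU).fun_add (integrable_inner_const_left D.v hU)
  have e : ∫ ω, (qf D.Q₁ (X ω) + qf D.R₁ (U ω) + inner ℝ D.s (X ω) + inner ℝ D.v (U ω) + D.c) ∂Pr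
      = ∫ ω, (qf D.Q₁ (X ω) + inner ℝ D.s (X ω)) ∂Pr
        + ∫ ω, (qf D.R₁ (U ω) + inner ℝ D.v (U ω)) ∂Pr + D.c := by
    have e1 : ∫ _, D.c ∂Pr = D.c := by simp
    have e2 := integral_add (i1.fun_add i2) (integrable_const D.c)
    rw [integral_add i1 i2, e1] at e2
    rw [← e2]
    refine integral_congr_ae (Filter.Eventually.of_forall fun ω => ?_)
    simp only
    ring
  rw [Data.cost, e]
  ring

/-- One step of the dissipation inequality at a state `Y` and control `U' = π(Y)`. -/
theorem dissipation_step (hQ₁ : D.Q₁.PosSemidef) (hQ₂ : D.Q₂.PosSemidef) (hR₁ : D.R₁.PosDef)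
    (hR₂ : D.R₂.PosSemidef) {P S : Matrix (Fin n) (Fin n) ℝ} (hP : D.IsRiccatiSolution P)
    (hS : S.PosDef) {c : ℝ} (h : ∀ x u, c * ‖x‖ ^ 2 ≤
      qf D.Q₁ x + qf D.R₁ u + qf S x - qf S (mv D.A x + mv D.B u))
    {xs xt q : Vec n} {us ut : Vec l} {W : Ω → Vec m} (hW : MemLp W 2 Pr)
    (hss : xs - mv D.A xs - mv D.B us = mv D.E (∫ ω, W ω ∂Pr) + D.z)
    (ht : xt - mv D.A xt - mv D.B ut = 0)
    (hopt : ∀ x u, 2 * inner ℝ x (mv D.Q₁ (xs + xt)) + inner ℝ D.s x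
        + (2 * inner ℝ u (mv D.R₁ (us + ut)) + inner ℝ D.v u)
        + inner ℝ q (x - mv D.A x - mv D.B u) = 0)
    {X Y : Ω → Vec n} {U U' : Ω → Vec l} (hX : MemLp X 2 Pr) (hU : MemLp U 2 Pr)
    (hY : MemLp Y 2 Pr) (hXW : IndepFun X W Pr) (hUW : IndepFun U W Pr) (hYW : IndepFun Y W Pr)
    (hU' : ∀ ω, U' ω = D.feedback P xs xt us ut (Y ω)) (hYmean : ∫ ω, Y ω ∂Pr = xs + xt)
    (hYinv : IdentDistrib (fun ω => D.f (Y ω) (U' ω) (W ω)) Y Pr Pr) :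
    c * ∫ ω, ‖X ω - Y ω‖ ^ 2 ∂Pr ≤ D.cost Pr X U - D.cost Pr Y U'
      + (∫ ω, storageIntegrand P S (q - (2 : ℝ) • mv S xt) xs xt (X ω) (Y ω) ∂Pr)
      - ∫ ω, storageIntegrand P S (q - (2 : ℝ) • mv S xt) xs xt
          (D.f (X ω) (U ω) (W ω)) (D.f (Y ω) (U' ω) (W ω)) ∂Pr := by
  have hZ := memLp_sub_const hY (xs + xt)
  have hU'eq : U' = fun ω => mv (D.gain P) (Y ω - (xs + xt)) + (us + ut) :=
    funext fun ω => by rw [hU', feedback_eq]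
  have hU'2 : MemLp U' 2 Pr := by
    rw [hU'eq]; exact (memLp_mv _ hZ).add (memLp_const _)
  have hU'mean : ∫ ω, U' ω ∂Pr = us + ut := by
    rw [hU'eq, integral_add (integrable_of_memLp_two (memLp_mv _ hZ)) (integrable_const _),
      integral_mv _ hZ, integral_sub_mean hY hYmean, mv_zero]
    simp
  have hU'W : IndepFun U' W Pr := by
    rw [funext hU']
    exact hYW.comp (measurable_feedback P xs xt us ut) measurable_id
  have hX' := memLp_f (D := D) hX hU hW
  have hY' := memLp_f (D := D) hY hU'2 hW
  have hY'mean : ∫ ω, D.f (Y ω) (U' ω) (W ω) ∂Pr = xs + xt := by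
    rw [hYinv.integral_eq, hYmean]
  have hZ' := memLp_sub_const hY' (xs + xt)
  have hw := memLp_sub_const hW (∫ ω, W ω ∂Pr)
  have hPE := memLp_mv P (memLp_mv D.E hw)
  have hPE0 : ∫ ω, mv P (mv D.E (W ω - ∫ ω, W ω ∂Pr)) ∂Pr = 0 := by
    rw [integral_mv P (memLp_mv D.E hw), integral_mv D.E hw, integral_sub_mean hW rfl, mv_zero,
      mv_zero]
  have hmeas : Measurable fun w : Vec m => mv P (mv D.E (w - ∫ ω, W ω ∂Pr)) := by fun_prop
  have hind : ∀ {a : ℕ} (M : Matrix (Fin n) (Fin a) ℝ) {V : Ω → Vec a}, MemLp V 2 Pr →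
      IndepFun V W Pr →
      ∫ ω, inner ℝ (mv M (V ω)) (mv P (mv D.E (W ω - ∫ ω, W ω ∂Pr))) ∂Pr = 0 := by
    intro a M V hV hVW
    rw [integral_inner_of_indepFun (memLp_mv M hV) hPE (hVW.comp (measurable_mv M) hmeas), hPE0,
      inner_zero_right]
  have hΔ : MemLp (fun ω => D.f (X ω) (U ω) (W ω) - D.f (Y ω) (U' ω) (W ω)) 2 Pr := hX'.sub hY'
  have z1 : ∫ ω, inner ℝ xt (mv P (Y ω - (xs + xt))) ∂Pr = 0 := by
    rw [integral_inner_const_left _ (memLp_mv _ hZ), integral_mv _ hZ,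
      integral_sub_mean hY hYmean, mv_zero, inner_zero_right]
  have z2 : ∫ ω, inner ℝ xt (mv P (D.f (Y ω) (U' ω) (W ω) - (xs + xt))) ∂Pr = 0 := by
    rw [integral_inner_const_left _ (memLp_mv _ hZ'), integral_mv _ hZ',
      integral_sub_mean hY' hY'mean, mv_zero, inner_zero_right]
  -- Stationarity enters here: successor and current state have the same law.
  have z3 : ∫ ω, qf P (D.f (Y ω) (U' ω) (W ω) - (xs + xt)) ∂Pr
      = ∫ ω, qf P (Y ω - (xs + xt)) ∂Pr := by
    have hm : Measurable fun y => qf P (y - (xs + xt)) :=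
      ((continuous_qf P).comp (continuous_sub_right _)).measurable
    exact (hYinv.comp hm).integral_eq
  have z4 : ∫ ω, inner ℝ (D.f (X ω) (U ω) (W ω) - D.f (Y ω) (U' ω) (W ω))
      (mv P (mv D.E (W ω - ∫ ω, W ω ∂Pr))) ∂Pr = 0 := by
    have hint : ∀ {a : ℕ} (M : Matrix (Fin n) (Fin a) ℝ) {V : Ω → Vec a}, MemLp V 2 Pr →
        Integrable (fun ω => inner ℝ (mv M (V ω)) (mv P (mv D.E (W ω - ∫ ω, W ω ∂Pr)))) Pr :=
      fun M _ hV => integrable_inner_of_memLp (memLp_mv M hV) hPE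
    -- The noise cancels in the difference of successors. Linearity then separates states from
    -- controls, so independence of each from W suffices, without joint independence.
    simp only [f_sub_f, mv_sub D.A, mv_sub D.B, inner_add_left, inner_sub_left]
    rw [integral_add ((hint _ hX).sub' (hint _ hY)) ((hint _ hU).sub' (hint _ hU'2)),
      integral_sub (hint _ hX) (hint _ hY), integral_sub (hint _ hU) (hint _ hU'2),
      hind _ hX hXW, hind _ hY hYW, hind _ hU hUW, hind _ hU'2 hU'W]
    simp
  have hDX : MemLp (fun ω => X ω - Y ω) 2 Pr := hX.sub hY
  have hDU : MemLp (fun ω => U ω - U' ω) 2 Pr := hU.sub hU'2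
  have hZU := memLp_sub_const hU'2 (us + ut)
  have c1 := integral_le_meanVarianceCost_sub (PosSemidef.transpose_eq hQ₁) hQ₂ D.s hX hY hYmean
  have c2 := integral_le_meanVarianceCost_sub (PosSemidef.transpose_eq hR₁.posSemidef) hR₂ D.v
    hU hU'2 hU'mean
  have i1 := (((integrable_qf D.Q₁ hDX).fun_add
      ((integrable_inner_of_memLp hDX (memLp_const (mv D.Q₁ (xs + xt)))).const_mul 2)).fun_add
      ((integrable_inner_mv (D.Q₁ + D.Q₂) hDX hZ).const_mul 2)).fun_add
      (integrable_inner_const_left D.s hDX)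
  have i2 := (((integrable_qf D.R₁ hDU).fun_add
      ((integrable_inner_of_memLp hDU (memLp_const (mv D.R₁ (us + ut)))).const_mul 2)).fun_add
      ((integrable_inner_mv (D.R₁ + D.R₂) hDU hZU).const_mul 2)).fun_add
      (integrable_inner_const_left D.v hDU)
  have i3 := integrable_storageIntegrand P S (q - (2 : ℝ) • mv S xt) xs xt hX hY
  have i4 := integrable_storageIntegrand P S (q - (2 : ℝ) • mv S xt) xs xt hX' hY'
  have i5 := (integrable_inner_const_left xt (memLp_mv P hZ)).const_mul 2
  have i6 := (integrable_inner_const_left xt (memLp_mv P hZ')).const_mul 2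
  have i7 := integrable_qf P hZ
  have i8 := integrable_qf P hZ'
  have i9 := (integrable_inner_of_memLp hΔ hPE).const_mul 2
  have hmono := integral_mono ((integrable_norm_sq hDX).const_mul c)
    ((((((((i1.fun_add i2).fun_add i3).sub' i4).fun_add i5).sub' i6).fun_add i7).sub' i8).sub' i9)
    fun ω => pointwise_dissipation hR₁ hR₂ hP hS h hss ht hopt (X ω) (Y ω) (U ω) (U' ω)
      (hU' ω) (W ω)
  rw [integral_sub (((((((i1.fun_add i2).fun_add i3).sub' i4).fun_add i5).sub' i6).fun_add
      i7).sub' i8) i9,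
    integral_sub ((((((i1.fun_add i2).fun_add i3).sub' i4).fun_add i5).sub' i6).fun_add i7) i8,
    integral_add (((((i1.fun_add i2).fun_add i3).sub' i4).fun_add i5).sub' i6) i7,
    integral_sub ((((i1.fun_add i2).fun_add i3).sub' i4).fun_add i5) i6,
    integral_add (((i1.fun_add i2).fun_add i3).sub' i4) i5,
    integral_sub ((i1.fun_add i2).fun_add i3) i4,
    integral_add (i1.fun_add i2) i3, integral_add i1 i2, integral_const_mul, integral_const_mul,
    integral_const_mul, integral_const_mul, z1, z2, z3, z4] at hmono
  rw [cost_eq hX hU, cost_eq hY hU'2]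
  linarith

end Dissipativity

/-! ### From dissipativity to turnpike bounds; comparison functions. -/

section Turnpike

/-- Markov-type counting: each exceptional time contributes at least a to a sum bounded by T. -/
theorem sub_div_le_ncard {N : ℕ} {p : ℕ → Prop} {b : ℕ → ℝ} {a T : ℝ} (ha : 0 < a)
    (hb : ∀ k < N, 0 ≤ b k) (hp : ∀ k < N, ¬p k → a ≤ b k)
    (hT : ∑ k ∈ Finset.range N, b k ≤ T) :
    (N : ℝ) - T / a ≤ Set.ncard {k : ℕ | k < N ∧ p k} := by
  classical
  have hset : {k : ℕ | k < N ∧ p k} = ((Finset.range N).filter p : Set ℕ) := by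
    ext k; simp
  rw [hset, Set.ncard_coe_finset]
  have hcard := Finset.card_filter_add_card_filter_not (s := Finset.range N) p
  rw [Finset.card_range] at hcard
  have h1 : (((Finset.range N).filter fun k => ¬p k).card : ℝ) * a ≤ T := by
    rw [← nsmul_eq_mul]
    refine (Finset.card_nsmul_le_sum _ b a fun k hk => ?_).trans
      ((Finset.sum_le_sum_of_subset_of_nonneg (Finset.filter_subset _ _)
        fun k hk _ => hb k (Finset.mem_range.mp hk)).trans hT)
    rw [Finset.mem_filter, Finset.mem_range] at hk
    exact hp k hk.1 hk.2
  rw [← le_div_iff₀ ha] at h1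
  have h2 : (((Finset.range N).filter p).card : ℝ)
      + (((Finset.range N).filter fun k => ¬p k).card : ℝ) = N := by exact_mod_cast hcard
  linarith

variable {n l m : ℕ} {D : Data n l m} {Ω : Type*} [MeasurableSpace Ω] {Pr : Measure Ω}

theorem IsStrictlyDissipative.mono {W : ℕ → Ω → Vec m} {Xs : ℕ → Ω → Vec n}
    {Us : ℕ → Ω → Vec l} {lam : ℕ → (Ω → Vec n) → ℝ} {α β : ℝ → ℝ}
    (hdiss : D.IsStrictlyDissipative Pr W Xs Us lam β) (hα : IsClassKInfty α)
    (hαβ : ∀ t, 0 ≤ t → α t ≤ β t) : D.IsStrictlyDissipative Pr W Xs Us lam α where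
  bddBelow := hdiss.bddBelow
  kInfty := hα
  ineq k X U hX hU hXW hUW :=
    (hαβ _ (integral_nonneg fun ω => by positivity)).trans (hdiss.ineq k X U hX hU hXW hUW)

variable [IsProbabilityMeasure Pr]

theorem IsAdmissible.memLp_traj {W : ℕ → Ω → Vec m} (hW2 : ∀ k, MemLp (W k) 2 Pr)
    {X₀ : Ω → Vec n} (hX₀ : MemLp X₀ 2 Pr) {N : ℕ} {U : ℕ → Ω → Vec l}
    (hU : D.IsAdmissible Pr W X₀ N U) {k : ℕ} (hk : k ≤ N) : MemLp (D.traj W X₀ U k) 2 Pr := by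
  induction k with
  | zero => exact hX₀
  | succ k ih => exact memLp_f (ih (by omega)) (hU.memLp k (by omega)) (hW2 k)

/-- Strict dissipativity implies the turnpike property of the first two moments. -/
theorem IsStrictlyDissipative.momentTurnpike {W : ℕ → Ω → Vec m}
    (hW2 : ∀ k, MemLp (W k) 2 Pr) {Xs : ℕ → Ω → Vec n} {Us : ℕ → Ω → Vec l}
    (hXs : ∀ k, MemLp (Xs k) 2 Pr) {lam : ℕ → (Ω → Vec n) → ℝ} {β : ℝ → ℝ}
    (hdiss : D.IsStrictlyDissipative Pr W Xs Us lam β) {a₁ a₂ : ℝ → ℝ}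
    (h₁ : ∀ ε, 0 < ε → 0 < a₁ ε ∧ a₁ ε ≤ β (ε ^ 2))
    (h₂ : ∀ ε, 0 < ε → 0 < a₂ ε ∧ a₂ ε ≤ β (ε ^ 2)) :
    D.MomentTurnpike Pr W Xs Us a₁ a₂ := by
  intro X₀ _ hX₀
  obtain ⟨b, hb⟩ := hdiss.bddBelow
  -- What survives telescoping is the initial storage minus the terminal one, and the latter is at
  -- least `b` for every horizon.
  refine ⟨lam 0 X₀ - b, fun N δ _ U hU hcost ε hε => ?_⟩
  have htraj : ∀ k ≤ N, MemLp (D.traj W X₀ U k) 2 Pr := fun k hk =>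
    IsAdmissible.memLp_traj hW2 hX₀ hU hk
  have hnn : ∀ k, 0 ≤ ∫ ω, ‖D.traj W X₀ U k ω - Xs k ω‖ ^ 2 ∂Pr := fun k =>
    integral_nonneg fun ω => by positivity
  have hmono : ∀ s t, 0 ≤ s → s ≤ t → β s ≤ β t := fun s t hs hst =>
    hdiss.kInfty.strictMonoOn.monotoneOn hs (hs.trans hst) hst
  have hsum : ∑ k ∈ Finset.range N, β (∫ ω, ‖D.traj W X₀ U k ω - Xs k ω‖ ^ 2 ∂Pr)
      ≤ δ + (lam 0 X₀ - b) := by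
    have hstep : ∀ k ∈ Finset.range N, β (∫ ω, ‖D.traj W X₀ U k ω - Xs k ω‖ ^ 2 ∂Pr)
        ≤ (D.cost Pr (D.traj W X₀ U k) (U k) - D.cost Pr (Xs k) (Us k))
          + (lam k (D.traj W X₀ U k) - lam (k + 1) (D.traj W X₀ U (k + 1))) := by
      intro k hk
      rw [Finset.mem_range] at hk
      have := hdiss.ineq k _ _ (htraj k hk.le) (hU.memLp k hk) (hU.indep_state k hk)
        (hU.indep_control k hk)
      exact this.trans (le_of_eq (add_sub_assoc _ _ _))
    refine (Finset.sum_le_sum hstep).trans ?_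
    rw [Finset.sum_add_distrib, Finset.sum_sub_distrib,
      Finset.sum_range_sub' fun k => lam k (D.traj W X₀ U k)]
    have h3 := hb N _ (htraj N le_rfl)
    have h4 : D.traj W X₀ U 0 = X₀ := rfl
    rw [h4]
    have h5 : ∑ k ∈ Finset.range N, D.cost Pr (D.traj W X₀ U k) (U k)
      ≤ δ + ∑ k ∈ Finset.range N, D.cost Pr (Xs k) (Us k) := hcost
    linarith
  have hβ : ∀ k < N, 0 ≤ β (∫ ω, ‖D.traj W X₀ U k ω - Xs k ω‖ ^ 2 ∂Pr) := fun k _ => by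
    rw [← hdiss.kInfty.map_zero]; exact hmono _ _ le_rfl (hnn k)
  constructor
  · refine sub_div_le_ncard (h₁ ε hε).1 hβ (fun k hk hbad => ?_) hsum
    rw [not_le] at hbad
    refine (h₁ ε hε).2.trans (hmono _ _ (by positivity) ?_)
    exact (pow_le_pow_left₀ hε.le hbad.le 2).trans
      (norm_integral_sub_sq_le (htraj k hk.le) (hXs k))
  · refine sub_div_le_ncard (h₂ ε hε).1 hβ (fun k hk hbad => ?_) hsum
    rw [not_le] at hbad
    refine (h₂ ε hε).2.trans (hmono _ _ (by positivity) ?_)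
    exact (pow_le_pow_left₀ hε.le hbad.le 2).trans
      (abs_sqrt_trace_covMat_sub_sq_le (htraj k hk.le) (hXs k))

theorem isClassKInfty_linear {c : ℝ} (hc : 0 < c) : IsClassKInfty fun t => c * t where
  continuousOn := by fun_prop
  strictMonoOn := fun _ _ _ _ h => mul_lt_mul_of_pos_left h hc
  map_zero := mul_zero c
  unbounded b := ⟨|b| / c, by positivity, by
    rw [mul_div_cancel₀ _ hc.ne']; exact le_abs_self b⟩

/-- The minimum with t keeps the function below the linear rate c t, while t⁴/4 keeps its values at
√ε and √(2ε) below cε². -/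
theorem isClassKInfty_min {c : ℝ} (hc : 0 < c) :
    IsClassKInfty fun t => c * min t (t ^ 4 / 4) where
  continuousOn := by fun_prop
  strictMonoOn := fun s hs t _ h => by
    have hs' : (0 : ℝ) ≤ s := hs
    have h4 : s ^ 4 / 4 < t ^ 4 / 4 := by gcongr
    exact mul_lt_mul_of_pos_left (lt_min ((min_le_left _ _).trans_lt h)
      ((min_le_right _ _).trans_lt h4)) hc
  map_zero := by simp
  unbounded b := by
    refine ⟨max 2 (|b| / c), by positivity, ?_⟩
    set t := max 2 (|b| / c)
    have ht : 2 ≤ t := le_max_left _ _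
    have h1 : t ≤ t ^ 4 / 4 := by
      have h2 : 8 ≤ t ^ 3 := by
        calc (8 : ℝ) = 2 ^ 3 := by norm_num
          _ ≤ t ^ 3 := by gcongr
      nlinarith
    rw [min_eq_left h1]
    calc b ≤ |b| := le_abs_self b
      _ = c * (|b| / c) := by field_simp
      _ ≤ c * t := by gcongr; exact le_max_right _ _

end Turnpike

/-! ### The stationary closed loop and its dissipativity. -/

section ClosedLoop

variable {n l m : ℕ} {D : Data n l m} {Ω : Type*} [MeasurableSpace Ω] {Pr : Measure Ω}

theorem eq_zero_of_fixed {d : ℕ} {M : Matrix (Fin d) (Fin d) ℝ} {C r : ℝ} (hr0 : 0 ≤ r)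
    (hr : r < 1) (hM : ∀ k x, ‖mv (M ^ k) x‖ ≤ C * r ^ k * ‖x‖) {x : Vec d} (hx : mv M x = x) :
    x = 0 := by
  have hfix : ∀ k, mv (M ^ k) x = x := by
    intro k
    induction k with
    | zero => rw [pow_zero, one_mv]
    | succ k ih => rw [pow_succ, mul_mv, hx, ih]
  have hlim : Filter.Tendsto (fun k : ℕ => C * r ^ k * ‖x‖) Filter.atTop (nhds 0) := by
    simpa using ((tendsto_pow_atTop_nhds_zero_of_lt_one hr0 hr).const_mul C).mul_const ‖x‖
  exact norm_le_zero_iff.mp (ge_of_tendsto' hlim fun k => by simpa [hfix] using hM k x)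

theorem measurable_closedLoopMap (P : Matrix (Fin n) (Fin n) ℝ) (xs xt : Vec n)
    (us ut : Vec l) :
    Measurable fun p : Vec n × Vec m => D.f p.1 (D.feedback P xs xt us ut p.1) p.2 := by
  unfold Data.f Data.feedback; fun_prop

/-- Every probability law on Euclidean space is a measurable image of Lebesgue measure on the unit
interval. -/
theorem exists_hasLaw_of_uniform {𝓦 : Type*} [MeasurableSpace 𝓦] {W : Ω → 𝓦}
    {ρ : Measure (Vec n)} [IsProbabilityMeasure ρ]
    (h : ∃ ξ : Ω → unitInterval, Measurable ξ ∧ HasLaw ξ volume Pr ∧ IndepFun ξ W Pr) :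
    ∃ X : Ω → Vec n, Measurable X ∧ HasLaw X ρ Pr ∧ IndepFun X W Pr := by
  obtain ⟨ξ, hξ, hlaw, hind⟩ := h
  obtain ⟨g, hg, hgρ⟩ := ρ.exists_measurable_map_eq
  refine ⟨g ∘ ξ, hg.comp hξ, ⟨(hg.comp hξ).aemeasurable, ?_⟩, hind.comp hg measurable_id⟩
  rw [← Measure.map_map hg hξ, hlaw.map_eq, hgρ]

theorem storage_eq (P S : Matrix (Fin n) (Fin n) ℝ) (q xs xt : Vec n) (Xs : ℕ → Ω → Vec n)
    (k : ℕ) (X : Ω → Vec n) :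
    storage Pr P S q xs xt Xs k X = ∫ ω, storageIntegrand P S q xs xt (X ω) (Xs k ω) ∂Pr :=
  rfl

theorem HasLaw.memLp_two {d : ℕ} {ρ : Measure (Vec d)} (hρ : MemLp id 2 ρ) {X : Ω → Vec d}
    (hX : HasLaw X ρ Pr) : MemLp X 2 Pr := by
  rw [← hX.map_eq] at hρ
  exact (memLp_map_measure_iff (by fun_prop) hX.aemeasurable).mp hρ

theorem HasLaw.identDistrib {d : ℕ} {ρ : Measure (Vec d)} {X Y : Ω → Vec d}
    (hX : HasLaw X ρ Pr) (hY : HasLaw Y ρ Pr) : IdentDistrib X Y Pr Pr :=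
  ⟨hX.aemeasurable, hY.aemeasurable, by rw [hX.map_eq, hY.map_eq]⟩

variable [IsProbabilityMeasure Pr]

/-- Existence of an invariant law with finite second moment of the closed loop. -/
theorem exists_closedLoop_invariant_measure {W : ℕ → Ω → Vec m} (hWm : ∀ k, Measurable (W k))
    (hW2 : ∀ k, MemLp (W k) 2 Pr) (hWind : iIndepFun W Pr)
    (hWid : ∀ k, IdentDistrib (W k) (W 0) Pr Pr) {P : Matrix (Fin n) (Fin n) ℝ} {C r : ℝ}
    (hr : r < 1) (hM : ∀ k x, ‖mv (D.closedLoop P ^ k) x‖ ≤ C * r ^ k * ‖x‖)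
    {xs xt : Vec n} {us ut : Vec l} {μ : Vec m}
    (hss : xs - mv D.A xs - mv D.B us = mv D.E μ + D.z)
    (ht : xt - mv D.A xt - mv D.B ut = 0) :
    ∃ ρ : Measure (Vec n), IsProbabilityMeasure ρ ∧ MemLp id 2 ρ ∧
      (ρ.prod (Pr.map (W 0))).map
        (fun p => D.f p.1 (D.feedback P xs xt us ut p.1) p.2) = ρ := by
  -- Chosen so that the closed loop reads x ↦ Mx + (Ew + b), with all affine terms moved into the
  -- noise.
  set b : Vec n := xs + xt - mv (D.closedLoop P) (xs + xt) - mv D.E μ with hb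
  set g : Vec m → Vec n := fun w => mv D.E w + b with hg
  have hgm : Measurable g := by fun_prop
  obtain ⟨ρ, hρ, hρ2, hinv⟩ := exists_invariant_measure (G := fun k ω => g (W k ω)) hr hM
    (fun k => hgm.comp (hWm k)) (fun k => (memLp_mv _ (hW2 k)).add (memLp_const b))
    (hWind.comp (fun _ => g) fun _ => hgm) (fun k => (hWid k).comp hgm)
  refine ⟨ρ, hρ, hρ2, ?_⟩
  have hν := Measure.isProbabilityMeasure_map (μ := Pr) (hWm 0).aemeasurable
  have hfun : (fun p : Vec n × Vec m => D.f p.1 (D.feedback P xs xt us ut p.1) p.2)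
      = (fun p : Vec n × Vec n => mv (D.closedLoop P) p.1 + p.2) ∘ Prod.map id g := by
    funext p
    have := f_feedback_sub (P := P) hss ht p.1 p.2
    rw [sub_eq_iff_eq_add] at this
    rw [this, Function.comp_apply, Prod.map_fst, Prod.map_snd, id, hg, hb]
    simp only [mv_sub]
    abel
  have hmap : Pr.map (fun ω => g (W 0 ω)) = (Pr.map (W 0)).map g :=
    (Measure.map_map hgm (hWm 0)).symm
  rw [hmap] at hinv
  have hprod : ρ.prod ((Pr.map (W 0)).map g)
      = (ρ.prod (Pr.map (W 0))).map (Prod.map id g) := by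
    rw [← Measure.map_prod_map _ _ measurable_id hgm, Measure.map_id]
  rw [hfun, ← Measure.map_map (by fun_prop) (by fun_prop), ← hprod]
  exact hinv

/-- The closed-loop process started in the invariant law is stationary. -/
theorem isStationaryPair_closedLoop {W : ℕ → Ω → Vec m} (hWm : ∀ k, Measurable (W k))
    (hWind : iIndepFun W Pr) (hWid : ∀ k, IdentDistrib (W k) (W 0) Pr Pr)
    {P : Matrix (Fin n) (Fin n) ℝ} {xs xt : Vec n} {us ut : Vec l} {ρ : Measure (Vec n)}
    [IsProbabilityMeasure ρ] (hρ2 : MemLp id 2 ρ)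
    (hinv : (ρ.prod (Pr.map (W 0))).map
        (fun p => D.f p.1 (D.feedback P xs xt us ut p.1) p.2) = ρ)
    {Xs : ℕ → Ω → Vec n} {Us : ℕ → Ω → Vec l} (hX0 : Measurable (Xs 0))
    (hlaw : HasLaw (Xs 0) ρ Pr) (hind : IndepFun (Xs 0) (fun ω k => W k ω) Pr)
    (hUs : ∀ k ω, Us k ω = D.feedback P xs xt us ut (Xs k ω))
    (hXs : ∀ k ω, Xs (k + 1) ω = D.f (Xs k ω) (Us k ω) (W k ω)) :
    (∀ k, HasLaw (Xs k) ρ Pr) ∧ D.IsStationaryPair Pr W Xs Us := by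
  have hg := measurable_closedLoopMap (D := D) P xs xt us ut
  have hrec : ∀ k ω, Xs (k + 1) ω
      = (fun p : Vec n × Vec m => D.f p.1 (D.feedback P xs xt us ut p.1) p.2) (Xs k ω, W k ω) :=
    fun k ω => by rw [hXs, hUs]
  have hfb := measurable_feedback (D := D) P xs xt us ut
  have hlaws : ∀ k, HasLaw (Xs k) ρ Pr :=
    hasLaw_of_recursion hWm hWind hWid hg hX0 hind hrec hinv hlaw
  have hindep : ∀ k, IndepFun (Xs k) (W k) Pr :=
    indepFun_noise_of_recursion hWm hWind hg hX0 hind hrec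
  have hUlaw : ∀ k, HasLaw (Us k) (ρ.map (D.feedback P xs xt us ut)) Pr := fun k => by
    rw [funext (hUs k)]
    refine ⟨hfb.comp_aemeasurable (hlaws k).aemeasurable, ?_⟩
    rw [← (hlaws k).map_eq, AEMeasurable.map_map_of_aemeasurable hfb.aemeasurable
      (hlaws k).aemeasurable]
    rfl
  refine ⟨hlaws, ⟨ρ, inferInstance, hρ2, hlaws⟩, ⟨_, ?_, ?_, hUlaw⟩,
    fun k => Filter.Eventually.of_forall (hXs k), hindep, fun k => ?_⟩
  · exact Measure.isProbabilityMeasure_map hfb.aemeasurable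
  · rw [memLp_map_measure_iff (by fun_prop) hfb.aemeasurable]
    exact (((memLp_mv _ ((hρ2.sub (memLp_const xt)).sub (memLp_const xs))).add
      (memLp_const ut)).add (memLp_const us))
  · rw [funext (hUs k)]
    exact (hindep k).comp hfb measurable_id

/-- The mean of the invariant law is the optimal steady state. -/
theorem integral_closedLoop_eq {W : ℕ → Ω → Vec m} (hW2 : ∀ k, MemLp (W k) 2 Pr)
    {P : Matrix (Fin n) (Fin n) ℝ} {C r : ℝ} (hr0 : 0 ≤ r)
    (hr : r < 1) (hM : ∀ k x, ‖mv (D.closedLoop P ^ k) x‖ ≤ C * r ^ k * ‖x‖)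
    {xs xt : Vec n} {us ut : Vec l}
    (hss : xs - mv D.A xs - mv D.B us = mv D.E (∫ ω, W 0 ω ∂Pr) + D.z)
    (ht : xt - mv D.A xt - mv D.B ut = 0) {ρ : Measure (Vec n)} (hρ2 : MemLp id 2 ρ)
    {Xs : ℕ → Ω → Vec n} {Us : ℕ → Ω → Vec l}
    (hUs : ∀ k ω, Us k ω = D.feedback P xs xt us ut (Xs k ω))
    (hXs : ∀ k ω, Xs (k + 1) ω = D.f (Xs k ω) (Us k ω) (W k ω))
    (hlaws : ∀ k, HasLaw (Xs k) ρ Pr) (k : ℕ) : ∫ ω, Xs k ω ∂Pr = xs + xt := by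
  have hX2 : ∀ k, MemLp (Xs k) 2 Pr := fun k => HasLaw.memLp_two hρ2 (hlaws k)
  have hsame : ∀ j k, ∫ ω, Xs j ω ∂Pr = ∫ ω, Xs k ω ∂Pr := fun j k =>
    (HasLaw.identDistrib (hlaws j) (hlaws k)).integral_eq
  have hZ := memLp_sub_const (hX2 0) (xs + xt)
  have hw := memLp_sub_const (hW2 0) (∫ ω, W 0 ω ∂Pr)
  have hsub : ∀ k, ∫ ω, (Xs k ω - (xs + xt)) ∂Pr = (∫ ω, Xs k ω ∂Pr) - (xs + xt) := fun k => by
    rw [integral_sub (integrable_of_memLp_two (hX2 k)) (integrable_const _)]; simp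
  have h1 : ∫ ω, (Xs 1 ω - (xs + xt)) ∂Pr
      = mv (D.closedLoop P) (∫ ω, (Xs 0 ω - (xs + xt)) ∂Pr) := by
    have : ∀ ω, Xs 1 ω - (xs + xt) = mv (D.closedLoop P) (Xs 0 ω - (xs + xt))
        + mv D.E (W 0 ω - ∫ ω, W 0 ω ∂Pr) := fun ω => by
      rw [hXs 0, hUs]; exact f_feedback_sub hss ht _ _
    rw [integral_congr_ae (Filter.Eventually.of_forall this),
      integral_add (integrable_of_memLp_two (memLp_mv _ hZ))
        (integrable_of_memLp_two (memLp_mv _ hw)), integral_mv _ hZ, integral_mv _ hw,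
      integral_sub_mean (hW2 0) rfl, mv_zero, add_zero]
  -- By stationarity the mean deviation is a fixed point of the closed-loop matrix, hence zero.
  rw [hsub, hsub, hsame 1 0] at h1
  rw [hsame k 0, ← sub_eq_zero]
  exact eq_zero_of_fixed hr0 hr hM h1.symm

/-- Strict dissipativity with a linear comparison function at the stationary closed loop. -/
theorem isStrictlyDissipative_closedLoop (hQ₁ : D.Q₁.PosSemidef) (hQ₂ : D.Q₂.PosSemidef)
    (hR₁ : D.R₁.PosDef) (hR₂ : D.R₂.PosSemidef) {P S : Matrix (Fin n) (Fin n) ℝ}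
    (hP : D.IsRiccatiSolution P) (hS : S.PosDef) {c : ℝ} (hc : 0 < c)
    (h : ∀ x u, c * ‖x‖ ^ 2 ≤ qf D.Q₁ x + qf D.R₁ u + qf S x - qf S (mv D.A x + mv D.B u))
    {xs xt q : Vec n} {us ut : Vec l} {W : ℕ → Ω → Vec m} (hW2 : ∀ k, MemLp (W k) 2 Pr)
    (hWid : ∀ k, IdentDistrib (W k) (W 0) Pr Pr)
    (hss : xs - mv D.A xs - mv D.B us = mv D.E (∫ ω, W 0 ω ∂Pr) + D.z)
    (ht : xt - mv D.A xt - mv D.B ut = 0)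
    (hopt : ∀ x u, 2 * inner ℝ x (mv D.Q₁ (xs + xt)) + inner ℝ D.s x
        + (2 * inner ℝ u (mv D.R₁ (us + ut)) + inner ℝ D.v u)
        + inner ℝ q (x - mv D.A x - mv D.B u) = 0)
    {ρ : Measure (Vec n)} (hρ2 : MemLp id 2 ρ)
    {Xs : ℕ → Ω → Vec n} {Us : ℕ → Ω → Vec l}
    (hUs : ∀ k ω, Us k ω = D.feedback P xs xt us ut (Xs k ω))
    (hXs : ∀ k ω, Xs (k + 1) ω = D.f (Xs k ω) (Us k ω) (W k ω))
    (hlaws : ∀ k, HasLaw (Xs k) ρ Pr) (hXW : ∀ k, IndepFun (Xs k) (W k) Pr)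
    (hmean : ∀ k, ∫ ω, Xs k ω ∂Pr = xs + xt) :
    D.IsStrictlyDissipative Pr W Xs Us
      (storage Pr P S (q - (2 : ℝ) • mv S xt) xs xt Xs) fun t => c * t where
  bddBelow := by
    obtain ⟨r, hr, hSr⟩ := PosDef.exists_le_qf hS
    have hX2 : ∀ k, MemLp (Xs k) 2 Pr := fun k => HasLaw.memLp_two hρ2 (hlaws k)
    set q' := q - (2 : ℝ) • mv S xt
    let g : Vec n → ℝ := fun y =>
      -((2 * ‖mvL P‖ * ‖y - (xs + xt)‖ + ‖q'‖) ^ 2 / (4 * r) + ‖mvL P‖ * ‖y - (xs + xt)‖ ^ 2)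
    have hgm : Measurable g := by fun_prop
    have hgi : ∀ k, Integrable (fun ω => g (Xs k ω)) Pr := fun k => by
      have hZ := memLp_sub_const (hX2 k) (xs + xt)
      exact (((((hZ.norm.const_mul _).add (memLp_const ‖q'‖)).integrable_sq).div_const _).add
        ((integrable_norm_sq hZ).const_mul _)).neg
    refine ⟨∫ ω, g (Xs 0 ω) ∂Pr, fun k X hX => ?_⟩
    -- The lower bound involves only the law of the reference state, which makes it uniform in time.
    have hk : ∫ ω, g (Xs 0 ω) ∂Pr = ∫ ω, g (Xs k ω) ∂Pr :=
      ((HasLaw.identDistrib (hlaws 0) (hlaws k)).comp hgm).integral_eq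
    rw [hk, storage_eq]
    exact integral_mono (hgi k) (integrable_storageIntegrand P S q' xs xt hX (hX2 k)) fun ω =>
      le_storageIntegrand (PosSemidef.transpose_eq hP.1) hr hSr q' xs xt (X ω) (Xs k ω)
  kInfty := isClassKInfty_linear hc
  ineq k X U hX hU hXW' hUW' := by
    have hX2 : ∀ k, MemLp (Xs k) 2 Pr := fun k => HasLaw.memLp_two hρ2 (hlaws k)
    have hstep : Xs (k + 1) = fun ω => D.f (Xs k ω) (Us k ω) (W k ω) := funext (hXs k)
    have hdist := HasLaw.identDistrib (hlaws (k + 1)) (hlaws k)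
    rw [hstep] at hdist
    rw [← (hWid k).integral_eq] at hss
    have := dissipation_step hQ₁ hQ₂ hR₁ hR₂ hP hS h (hW2 k) hss ht hopt hX hU (hX2 k) hXW' hUW'
      (hXW k) (hUs k) (hmean k) hdist
    simpa only [storage_eq, hstep] using this

end ClosedLoop

end StochLQ

/-! ### Assembly of the main theorem. -/

theorem mainTheorem5 {n l m : ℕ} (D : Data n l m)
    (hAB : IsStabilizable D.A D.B)
    (hQ₁ : D.Q₁.PosSemidef) (hQ₂ : D.Q₂.PosSemidef)
    (hR₁ : D.R₁.PosDef) (hR₂ : D.R₂.PosSemidef)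
    {Ω : Type*} [MeasurableSpace Ω] (Pr : Measure Ω) [IsProbabilityMeasure Pr]
    (W : ℕ → Ω → Vec m) (hWm : ∀ k, Measurable (W k)) (hW2 : ∀ k, MemLp (W k) 2 Pr)
    (hWind : iIndepFun W Pr) (hWid : ∀ k, IdentDistrib (W k) (W 0) Pr Pr)
    (xs : Vec n) (us : Vec l)
    (hss : xs - mv D.A xs - mv D.B us = mv D.E (∫ ω, W 0 ω ∂Pr) + D.z)
    (hdet : IsDetectable D.A (CFC.sqrt D.Q₁)) :
    ∃ (P S : Matrix (Fin n) (Fin n) ℝ) (q xt : Vec n) (ut : Vec l) (ρ : Measure (Vec n))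
      (α : ℝ → ℝ),
      D.IsRiccatiSolution P ∧ S.PosDef ∧ xt - mv D.A xt - mv D.B ut = 0 ∧
      -- `ρ` is an invariant distribution of the closed loop with finite second moment
      IsProbabilityMeasure ρ ∧ MemLp id 2 ρ ∧
      (ρ.prod (Pr.map (W 0))).map
        (fun p => D.f p.1 (D.feedback P xs xt us ut p.1) p.2) = ρ ∧
      -- an initial condition with law `ρ`, independent of the noise, exists as soon as the
      -- probability space carries a uniform random variable independent of the noise
      ((∃ ξ : Ω → unitInterval, Measurable ξ ∧ HasLaw ξ volume Pr ∧
          IndepFun ξ (fun ω k => W k ω) Pr) →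
        ∃ Xs₀ : Ω → Vec n, Measurable Xs₀ ∧ HasLaw Xs₀ ρ Pr ∧
          IndepFun Xs₀ (fun ω k => W k ω) Pr) ∧
      -- any closed-loop process started in such an initial condition has the claimed properties
      ∀ (Xs : ℕ → Ω → Vec n) (Us : ℕ → Ω → Vec l),
        Measurable (Xs 0) → HasLaw (Xs 0) ρ Pr → IndepFun (Xs 0) (fun ω k => W k ω) Pr →
        (∀ k ω, Us k ω = D.feedback P xs xt us ut (Xs k ω)) →
        (∀ k ω, Xs (k + 1) ω = D.f (Xs k ω) (Us k ω) (W k ω)) →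
        D.IsStationaryPair Pr W Xs Us ∧
        D.IsStrictlyDissipative Pr W Xs Us (storage Pr P S q xs xt Xs) α ∧
        D.MomentTurnpike Pr W Xs Us (fun ε => α √ε) (fun ε => α √(2 * ε)) ∧
        -- for an arbitrary comparison function of the dissipativity inequality
        ∀ (lam : ℕ → (Ω → Vec n) → ℝ) (β : ℝ → ℝ),
          D.IsStrictlyDissipative Pr W Xs Us lam β →
          D.MomentTurnpike Pr W Xs Us (fun ε => β (ε ^ 2)) (fun ε => β (ε ^ 2)) := by
  obtain ⟨S, hS, c, hc, hdiss⟩ := exists_storage_matrix D.B hQ₁ hR₁ hdet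
  obtain ⟨P, hP⟩ := exists_isRiccatiSolution hAB hQ₁ hQ₂ hR₁ hR₂
  obtain ⟨C, r, -, hr0, hr, hM⟩ := exists_closedLoop_pow_bound hQ₂ hR₁ hR₂ hP hS hc hdiss
  obtain ⟨xt, ut, q, ht, hopt⟩ := exists_optimal_steadyState hQ₁ hR₁ hc hdiss xs us
  obtain ⟨ρ, hρ, hρ2, hinv⟩ :=
    exists_closedLoop_invariant_measure hWm hW2 hWind hWid hr hM hss ht
  refine ⟨P, S, q - (2 : ℝ) • mv S xt, xt, ut, ρ, fun t => c * min t (t ^ 4 / 4), hP, hS, ht, hρ,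
    hρ2, hinv, exists_hasLaw_of_uniform, fun Xs Us hX0 hlaw hind hUs hXs => ?_⟩
  obtain ⟨hlaws, hstat⟩ := isStationaryPair_closedLoop hWm hWind hWid hρ2 hinv hX0 hlaw hind hUs
    hXs
  have hX2 : ∀ k, MemLp (Xs k) 2 Pr := fun k => HasLaw.memLp_two hρ2 (hlaws k)
  have hlin := isStrictlyDissipative_closedLoop hQ₁ hQ₂ hR₁ hR₂ hP hS hc hdiss hW2 hWid hss ht
    hopt hρ2 hUs hXs hlaws hstat.indep_state
    (integral_closedLoop_eq hW2 hr0 hr hM hss ht hρ2 hUs hXs hlaws)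
  -- Used with s = ε for the means and s = 2ε for the standard deviations; since √s⁴/4 = s²/4, the
  -- second case meets cε² exactly.
  have hrate : ∀ s ε : ℝ, 0 < ε → 0 < s → s ≤ 2 * ε →
      0 < c * min √s (√s ^ 4 / 4) ∧ c * min √s (√s ^ 4 / 4) ≤ c * ε ^ 2 := by
    intro s ε hε hs hsε
    have h4 : √s ^ 4 = s ^ 2 := by
      rw [show 4 = 2 * 2 from rfl, pow_mul, Real.sq_sqrt hs.le]
    refine ⟨by positivity, mul_le_mul_of_nonneg_left ((min_le_right _ _).trans ?_) hc.le⟩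
    rw [h4]
    nlinarith
  refine ⟨hstat, IsStrictlyDissipative.mono hlin (isClassKInfty_min hc) fun t _ =>
      mul_le_mul_of_nonneg_left (min_le_left _ _) hc.le,
    -- The stronger linear rate `hlin` is needed: it gives cε² at ε², which dominates both claimed
    -- rates.
    IsStrictlyDissipative.momentTurnpike hW2 hX2 hlin
      (fun ε hε => hrate ε ε hε hε (by linarith))
      (fun ε hε => hrate (2 * ε) ε hε (by linarith) le_rfl), fun lam β hβ => ?_⟩
  have hpos : ∀ ε : ℝ, 0 < ε → 0 < β (ε ^ 2) ∧ β (ε ^ 2) ≤ β (ε ^ 2) := fun ε hε => by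
    refine ⟨?_, le_rfl⟩
    rw [← hβ.kInfty.map_zero]
    exact hβ.kInfty.strictMonoOn Set.self_mem_Ici (Set.mem_Ici.mpr (by positivity))
      (by positivity)
  exact IsStrictlyDissipative.momentTurnpike hW2 hX2 hβ hpos hpos
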